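/- All graphs are finite and simple. An ordered graph is a graph together with a linear ordering $\prec$ of its vertex set. An ordered graph $G$ contains a copy of an ordered graph $H$ if some (not necessarily induced) subgraph of $G$, with the inherited vertex ordering, is isomorphic to $H$ by an order-preserving isomorphism. For an ordered graph $H$ on at least two vertices, let $f_\prec(H)=\sup\{\chi(G) : G \text{ is an ordered graph containing no copy of } H\}\in\mathbb{N}\cup\{\infty\}$. An ordered graph is non-crossing if it has no two edges $uv$ and $u'v'$ with $u\prec u'\prec v\prec v'$. A bonnet is an ordered graph with exactly $4$ or $5$ vertices that either has vertices $u_1\prec u_2\preceq u_3\prec u_4\preceq u_5$ and edges $u_1u_2,\ u_1u_5,\ u_3u_4$, or has vertices $u_1\preceq u_2\prec u_3\preceq u_4\prec u_5$ and edges $u_1u_5,\ u_4u_5,\ u_2u_3$. Theorem 3. Let $T$ be a non-crossing ordered graph on $k\ge 2$ vertices. Then $f_\prec(T)\neq\infty$ if and only if $T$ is a forest that does not contain a copy of a bonnet. Moreover, if $f_\prec(T)\neq\infty$, then $k-1\le f_\prec(T)\le 2^k$, and if in addition $T$ is connected, then $f_\prec(T)\le 2k-3$. Finally, for each $k\ge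 4$ there is a non-crossing ordered tree $T$ on $k$ vertices with $k\le f_\prec(T)\neq\infty$, while every ordered forest $T$ on $k$ vertices with $k\in\{2,3\}$ satisfies $f_\prec(T)=k-1$. -/

import Mathlib

/-!
An ordered graph is a simple graph `G : SimpleGraph V` on a linearly ordered vertex type `V`.
-/

namespace OrderedGraph

/-- `G` contains a copy of the ordered graph `H`: some (not necessarily induced) subgraph of `G`,
with the inherited vertex ordering, is isomorphic to `H` by an order preserving isomorphism. -/
def ContainsCopy {V W : Type*} [LinearOrder V] [LinearOrder W]
    (H : SimpleGraph V) (G : SimpleGraph W) : Prop :=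
  ∃ φ : V ↪o W, ∀ u v : V, H.Adj u v → G.Adj (φ u) (φ v)

/-- The (finite) ordered graphs that contain no copy of `H`. Up to an order preserving isomorphism,
every finite ordered graph is a graph on `Fin n` for exactly one `n`. -/
def Forb {V : Type*} [LinearOrder V] (H : SimpleGraph V) : Set (Σ n : ℕ, SimpleGraph (Fin n)) :=
  {G | ¬ ContainsCopy H G.2}

/-- `f_≺(H) = sup {χ(G) | G ∈ Forb_≺(H)}`, an element of `ℕ ∪ {∞}`. -/
noncomputable def fOrd {V : Type*} [LinearOrder V] (H : SimpleGraph V) : ℕ∞ :=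
  ⨆ G ∈ Forb H, G.2.chromaticNumber

/-- The edges `{u, v}` and `{u', v'}` cross if `u < u' < v < v'`; an ordered graph is crossing if it
contains two crossing edges. -/
def IsCrossing {V : Type*} [LinearOrder V] (H : SimpleGraph V) : Prop :=
  ∃ u v u' v' : V, H.Adj u v ∧ H.Adj u' v' ∧ u < u' ∧ u' < v ∧ v < v'

/-- A bonnet: an ordered graph with exactly 4 or 5 vertices, which are
either `u₁ < u₂ ≤ u₃ < u₄ ≤ u₅`, with edges exactly `u₁u₂, u₁u₅, u₃u₄`,
or `u₁ ≤ u₂ < u₃ ≤ u₄ < u₅`, with edges exactly `u₁u₅, u₄u₅, u₂u₃`. -/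
def IsBonnet {V : Type*} [Fintype V] [LinearOrder V] (B : SimpleGraph V) : Prop :=
  (Fintype.card V = 4 ∨ Fintype.card V = 5) ∧
  ∃ u₁ u₂ u₃ u₄ u₅ : V, (∀ x : V, x = u₁ ∨ x = u₂ ∨ x = u₃ ∨ x = u₄ ∨ x = u₅) ∧
    ((u₁ < u₂ ∧ u₂ ≤ u₃ ∧ u₃ < u₄ ∧ u₄ ≤ u₅ ∧
        B.edgeSet = {s(u₁, u₂), s(u₁, u₅), s(u₃, u₄)}) ∨
     (u₁ ≤ u₂ ∧ u₂ < u₃ ∧ u₃ ≤ u₄ ∧ u₄ < u₅ ∧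
        B.edgeSet = {s(u₁, u₅), s(u₄, u₅), s(u₂, u₃)}))

/-- `H` contains a copy of some bonnet. -/
def ContainsBonnet {V : Type*} [LinearOrder V] (H : SimpleGraph V) : Prop :=
  ∃ (n : ℕ) (B : SimpleGraph (Fin n)), IsBonnet B ∧ ContainsCopy B H

end OrderedGraph

/-!
Call a vertex with two neighbours on the same side that enclose an edge a fork
(`HasRightFork`, `HasLeftFork`). A fork is a bonnet or a triangle, and in a non-crossing ordered
graph every cycle yields a fork at its leftmost vertex (`isAcyclic_of_not_hasRightFork`). So for a
non-crossing `T` the condition "forest without bonnets" just says that `T` has no fork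
(`hasNoFork_iff`).

If `T` has a fork, then `f_≺(T) = ∞`: in the lexicographically ordered shift graph, the right
neighbours of a vertex lie in an interval without edges (`not_hasRightFork_shiftGraph`), while the
chromatic number of shift graphs is unbounded. The reverse ordering deals with left forks.

If `T` has no fork, then the bound `2 ^ k` follows by induction on the number of vertices
(`colorableOn_two_pow`). Deleting a vertex without neighbours costs at most a factor of two.
Otherwise let `r` be the farthest neighbour of the leftmost vertex `l`; no edge passes over `r`. If
`r` is not the last vertex, then `T` is cut at `r`, and the bounds for the two parts add up
(`colorableOn_of_split`). If `r` is the last vertex and `l` or `r` has a further neighbour, then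
the other one of the two is a leaf. This leaf is removed by deleting the farthest edge at each
vertex of the host graph (`exists_peeling`), which again costs a factor of two. If `l` and `r` are
adjacent to each other only, then no edge of the host graph passes over a copy of the rest of `T`,
and cutting the host graph greedily into intervals gives a factor of three for two vertices
(`colorableOn_of_wrap`).

For connected `T` only the cut and the removal of a leaf occur. Each leaf accounts for at most one
edge per vertex of the host graph (`adjPairs_le_of_segment`), so an uncut part on `k` vertices
forces degeneracy at most `2 * (k - 2)`, and hence the bound `2 * k - 3`.

The lower bound `k - 1` comes from the complete graph on `k - 1` vertices. It is not sharp for the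
tree `broom`, which is avoided by a suitably ordered Moser spindle preceded by universal vertices
(`not_containsCopy_broom`, `not_colorable_extendedSpindle`).
-/

namespace OrderedGraph

/-! ### Colourings of finite vertex sets -/

section Coloring

variable {W : Type*} {G : SimpleGraph W} {A : Finset W} {m n : ℕ}

/-- The subgraph of `G` induced by the finite set `A` has a proper colouring with colours
`0, …, n - 1`. -/
def ColorableOn (G : SimpleGraph W) (A : Finset W) (n : ℕ) : Prop :=
  ∃ c : W → ℕ, (∀ x ∈ A, c x < n) ∧ ∀ x ∈ A, ∀ y ∈ A, G.Adj x y → c x ≠ c y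

theorem ColorableOn.mono (h : ColorableOn G A m) (hmn : m ≤ n) : ColorableOn G A n := by
  obtain ⟨c, h1, h2⟩ := h
  exact ⟨c, fun x hx => (h1 x hx).trans_le hmn, h2⟩

theorem colorableOn_of_edgeless (h : ∀ x ∈ A, ∀ y ∈ A, ¬ G.Adj x y) : ColorableOn G A 1 :=
  ⟨fun _ => 0, fun _ _ => Nat.one_pos, fun x hx y hy hxy => (h x hx y hy hxy).elim⟩

theorem colorableOn_empty : ColorableOn G ∅ n :=
  ⟨fun _ => 0, by simp, by simp⟩

theorem colorableOn_add (p : W → Prop) [DecidablePred p]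
    (h1 : ColorableOn G (A.filter p) m) (h2 : ColorableOn G (A.filter fun x => ¬ p x) n) :
    ColorableOn G A (m + n) := by
  obtain ⟨c, hc, hc'⟩ := h1
  obtain ⟨d, hd, hd'⟩ := h2
  refine ⟨fun x => if p x then c x else m + d x, fun x hx => ?_, fun x hx y hy hxy => ?_⟩
  · by_cases hp : p x
    · have := hc x (by simp [hx, hp])
      simp only [hp, if_true]; omega
    · have := hd x (by simp [hx, hp])
      simp only [hp, if_false]; omega
  · by_cases hp : p x <;> by_cases hq : p y <;> simp only [hp, hq, if_true, if_false]
    · exact hc' x (by simp [hx, hp]) y (by simp [hy, hq]) hxy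
    · have := hc x (by simp [hx, hp])
      omega
    · have := hc y (by simp [hy, hq])
      omega
    · have := hd' x (by simp [hx, hp]) y (by simp [hy, hq]) hxy
      omega

/-- If every level of `g` is `n`-colourable, and `h` properly colours the edges that join different
levels of `g`, then `m * n` colours suffice. -/
theorem colorableOn_mul (g h : W → ℕ) (hm : ∀ x ∈ A, h x < m)
    (hgh : ∀ x ∈ A, ∀ y ∈ A, G.Adj x y → g x ≠ g y → h x ≠ h y)
    (hlev : ∀ i, ColorableOn G (A.filter fun x => g x = i) n) : ColorableOn G A (m * n) := by
  choose c hc hc' using hlev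
  have hlt : ∀ x ∈ A, c (g x) x < n := fun x hx => hc (g x) x (by simp [hx])
  refine ⟨fun x => h x * n + c (g x) x, fun x hx => ?_, fun x hx y hy hxy heq => ?_⟩
  · have h1 := hlt x hx
    have h2 : (h x + 1) * n ≤ m * n := Nat.mul_le_mul_right n (hm x hx)
    rw [Nat.add_mul] at h2
    simp only
    omega
  · have hx' := hlt x hx
    have hy' := hlt y hy
    have hn : 0 < n := by omega
    have hhe : h x = h y := by
      have := congrArg (· / n) heq
      simpa [Nat.add_comm, Nat.add_mul_div_right _ _ hn, Nat.div_eq_of_lt hx',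
        Nat.div_eq_of_lt hy'] using this
    have hge : g x = g y := by
      by_contra hne
      exact hgh x hx y hy hxy hne hhe
    have hce : c (g x) x = c (g x) y := by
      simp only [hhe, ← hge] at heq
      omega
    exact hc' (g x) x (by simp [hx]) y (by simp [hy, hge]) hxy hce

open Classical in
theorem colorableOn_of_degenerate {d : ℕ}
    (h : ∀ B ⊆ A, B.Nonempty → ∃ x ∈ B, (B.filter fun y => G.Adj x y).card ≤ d) :
    ColorableOn G A (d + 1) := by
  induction A using Finset.strongInduction with
  | H A ih =>
    rcases A.eq_empty_or_nonempty with rfl | hA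
    · exact colorableOn_empty
    obtain ⟨x, hx, hd⟩ := h A subset_rfl hA
    obtain ⟨c, hc, hc'⟩ := ih (A.erase x) (Finset.erase_ssubset hx)
      fun B hB => h B (hB.trans (Finset.erase_subset _ _))
    obtain ⟨i, hi, hi'⟩ : ∃ i ∈ Finset.range (d + 1),
        i ∉ (A.filter fun y => G.Adj x y).image c := by
      by_contra! hcon
      have h1 := Finset.card_le_card (show Finset.range (d + 1) ⊆ _ from hcon)
      have h2 := Finset.card_image_le (s := A.filter fun y => G.Adj x y) (f := c)
      rw [Finset.card_range] at h1
      omega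
    have hfree : ∀ y ∈ A, G.Adj x y → c y ≠ i := fun y hy hxy he =>
      hi' (Finset.mem_image.2 ⟨y, by simp [hy, hxy], he⟩)
    refine ⟨Function.update c x i, fun y hy => ?_, fun y hy z hz hyz => ?_⟩
    · by_cases hyx : y = x
      · subst hyx; simpa using hi
      · simpa [hyx] using hc y (by simp [hy, hyx])
    · by_cases hyx : y = x
      · subst hyx
        have hzy : z ≠ y := hyz.ne'
        simpa [hzy] using (hfree z hz hyz).symm
      · by_cases hzx : z = x
        · subst hzx
          simpa [hyx] using hfree y hy hyz.symm
        · simpa [hyx, hzx] using hc' y (by simp [hy, hyx]) z (by simp [hz, hzx]) hyz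

open Classical in
/-- If the number of ordered pairs of adjacent vertices in each `B ⊆ A` is at most `d * |B|`, then
`G` is `d`-degenerate on `A`. -/
theorem colorableOn_of_adjPairs_le {d : ℕ}
    (h : ∀ B ⊆ A, ((B ×ˢ B).filter fun p => G.Adj p.1 p.2).card ≤ d * B.card) :
    ColorableOn G A (d + 1) := by
  refine colorableOn_of_degenerate fun B hB hne => ?_
  by_contra! hcon
  have h1 : ((B ×ˢ B).filter fun p => G.Adj p.1 p.2).card =
      ∑ x ∈ B, (B.filter fun y => G.Adj x y).card := by
    rw [Finset.card_filter, Finset.sum_product]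
    exact Finset.sum_congr rfl fun x _ => (Finset.card_filter _ _).symm
  have h2 : ∑ x ∈ B, (d + 1) ≤ ∑ x ∈ B, (B.filter fun y => G.Adj x y).card :=
    Finset.sum_le_sum fun x hx => Nat.succ_le_of_lt (hcon x hx)
  have h3 := h B hB
  have h4 := hne.card_pos
  rw [h1] at h3
  rw [Finset.sum_const, smul_eq_mul] at h2
  nlinarith

end Coloring

/-! ### Copies of induced subgraphs -/

section Copy

variable {V W : Type*} [LinearOrder V] [LinearOrder W]

/-- The ordered subgraph of `G` induced by `A` contains a copy of the ordered subgraph of `T`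
induced by `S`. The values of the witnessing map outside `S` are irrelevant. -/
def CopyOn (T : SimpleGraph V) (S : Set V) (G : SimpleGraph W) (A : Set W) : Prop :=
  ∃ φ : V → W, (∀ u ∈ S, φ u ∈ A) ∧ (∀ u ∈ S, ∀ v ∈ S, u < v → φ u < φ v) ∧
    ∀ u ∈ S, ∀ v ∈ S, T.Adj u v → G.Adj (φ u) (φ v)

variable {T : SimpleGraph V} {S : Set V} {G : SimpleGraph W} {A B : Set W}

theorem CopyOn.mono (h : CopyOn T S G A) (hAB : A ⊆ B) : CopyOn T S G B := by
  obtain ⟨φ, h1, h2, h3⟩ := h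
  exact ⟨φ, fun u hu => hAB (h1 u hu), h2, h3⟩

theorem copyOn_univ_iff : CopyOn T Set.univ G Set.univ ↔ ContainsCopy T G := by
  constructor
  · rintro ⟨φ, -, h2, h3⟩
    exact ⟨OrderEmbedding.ofStrictMono φ fun u v => h2 u trivial v trivial,
      fun u v => h3 u trivial v trivial⟩
  · rintro ⟨φ, h⟩
    exact ⟨φ, fun _ _ => trivial, fun u _ v _ => φ.lt_iff_lt.2, fun u _ v _ => h u v⟩

/-- To extend a copy of `T[S \ {x}]` by a vertex `w` in the role of `x`, only the order and the
edges between `x` and the other vertices have to be checked. -/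
theorem copyOn_of_update [DecidableEq V] {x : V} {w : W} (φ : V → W)
    (hA : ∀ u ∈ S \ {x}, φ u ∈ A) (hlt : ∀ u ∈ S \ {x}, ∀ v ∈ S \ {x}, u < v → φ u < φ v)
    (hadj : ∀ u ∈ S \ {x}, ∀ v ∈ S \ {x}, T.Adj u v → G.Adj (φ u) (φ v))
    (hw : w ∈ A) (h1 : ∀ u ∈ S \ {x}, u < x → φ u < w) (h2 : ∀ u ∈ S \ {x}, x < u → w < φ u)
    (h3 : ∀ u ∈ S \ {x}, T.Adj u x → G.Adj (φ u) w) : CopyOn T S G A := by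
  have hmem : ∀ u ∈ S, u ≠ x → u ∈ S \ {x} := fun u hu hux => ⟨hu, hux⟩
  refine ⟨Function.update φ x w, fun u hu => ?_, fun u hu v hv huv => ?_, fun u hu v hv huv => ?_⟩
  · by_cases hux : u = x
    · simpa [hux] using hw
    · simpa [hux] using hA u (hmem u hu hux)
  · by_cases hux : u = x
    · subst hux
      simpa [huv.ne'] using h2 v (hmem v hv huv.ne') huv
    · by_cases hvx : v = x
      · subst hvx
        simpa [hux] using h1 u (hmem u hu hux) huv
      · simpa [hux, hvx] using hlt u (hmem u hu hux) v (hmem v hv hvx) huv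
  · by_cases hux : u = x
    · subst hux
      simpa [huv.ne'] using (h3 v (hmem v hv huv.ne') huv.symm).symm
    · by_cases hvx : v = x
      · subst hvx
        simpa [hux] using h3 u (hmem u hu hux) huv
      · simpa [hux, hvx] using hadj u (hmem u hu hux) v (hmem v hv hvx) huv

end Copy

/-! ### Deleting a vertex without neighbours -/

section Reductions

variable {V W : Type*} [LinearOrder V] [LinearOrder W]
variable {T : SimpleGraph V} {S : Finset V} {G : SimpleGraph W} {A : Finset W} {m n : ℕ}

theorem colorableOn_of_isolated_min {x : V} (hmin : ∀ v ∈ S, x ≤ v)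
    (hiso : ∀ v ∈ S, ¬ T.Adj v x)
    (ih : ∀ B : Finset W, ¬ CopyOn T (↑S \ {x}) G ↑B → ColorableOn G B n)
    (h : ¬ CopyOn T ↑S G ↑A) : ColorableOn G A (n + 1) := by
  classical
  rcases A.eq_empty_or_nonempty with rfl | hA
  · exact colorableOn_empty
  refine colorableOn_add (fun y => y ≠ A.min' hA) (ih _ ?_) (colorableOn_of_edgeless ?_)
  · rintro ⟨φ, h1, h2, h3⟩
    have h1' : ∀ u ∈ (S : Set V) \ {x}, φ u ∈ A ∧ φ u ≠ A.min' hA := by simpa using h1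
    refine h (copyOn_of_update (x := x) φ (fun u hu => (h1' u hu).1) h2 h3 (A.min'_mem hA) ?_ ?_ ?_)
    · intro u hu hux
      exact absurd (hmin u hu.1) hux.not_ge
    · intro u hu _
      exact lt_of_le_of_ne (A.min'_le _ (h1' u hu).1) (h1' u hu).2.symm
    · intro u hu hux
      exact (hiso u hu.1 hux).elim
  · intro y hy z hz hyz
    simp only [ne_eq, not_not, Finset.mem_filter] at hy hz
    exact hyz.ne (hy.2.trans hz.2.symm)

/-- A vertex without neighbours that is not extremal costs a factor of two: split `A` by the parity
of the rank, so that between any two vertices of the same part there is a further vertex of `A`. -/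
theorem colorableOn_of_isolated_between {x l r : V} (hl : l ∈ S) (hr : r ∈ S) (hlx : l < x)
    (hxr : x < r) (hiso : ∀ v ∈ S, ¬ T.Adj v x)
    (ih : ∀ B : Finset W, ¬ CopyOn T (↑S \ {x}) G ↑B → ColorableOn G B n)
    (h : ¬ CopyOn T ↑S G ↑A) : ColorableOn G A (2 * n) := by
  classical
  set g : W → ℕ := fun w => (A.filter (· < w)).card % 2 with hg
  have between : ∀ y ∈ A, ∀ z ∈ A, y < z → g y = g z → ∃ w ∈ A, y < w ∧ w < z := by
    intro y hy z hz hyz hgyz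
    by_contra! hcon
    have : A.filter (· < z) = insert y (A.filter (· < y)) := by
      ext w
      simp only [Finset.mem_filter, Finset.mem_insert]
      constructor
      · rintro ⟨hw, hwz⟩
        rcases lt_trichotomy w y with hwy | hwy | hwy
        · exact Or.inr ⟨hw, hwy⟩
        · exact Or.inl hwy
        · exact absurd hwz (hcon w hw hwy).not_gt
      · rintro (rfl | ⟨hw, hwy⟩)
        · exact ⟨hy, hyz⟩
        · exact ⟨hw, hwy.trans hyz⟩
    have hc := congrArg Finset.card this
    rw [Finset.card_insert_of_notMem (by simp)] at hc
    simp only [hg] at hgyz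
    omega
  refine colorableOn_mul g g (fun y _ => Nat.mod_lt _ two_pos) (fun _ _ _ _ _ hne => hne)
    fun i => ih _ ?_
  rintro ⟨φ, h1, h2, h3⟩
  have h1' : ∀ u ∈ (S : Set V) \ {x}, φ u ∈ A ∧ g (φ u) = i := by simpa using h1
  have hpne : (S.filter (· < x)).Nonempty := ⟨l, by simp [hl, hlx]⟩
  have hqne : (S.filter (x < ·)).Nonempty := ⟨r, by simp [hr, hxr]⟩
  set p := (S.filter (· < x)).max' hpne with hp
  set q := (S.filter (x < ·)).min' hqne with hq
  have hpm : p ∈ S ∧ p < x := Finset.mem_filter.1 ((S.filter (· < x)).max'_mem hpne)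
  have hqm : q ∈ S ∧ x < q := Finset.mem_filter.1 ((S.filter (x < ·)).min'_mem hqne)
  have hpS : p ∈ (S : Set V) \ {x} := ⟨hpm.1, hpm.2.ne⟩
  have hqS : q ∈ (S : Set V) \ {x} := ⟨hqm.1, hqm.2.ne'⟩
  obtain ⟨w, hw, hpw, hwq⟩ := between _ (h1' p hpS).1 _ (h1' q hqS).1
    (h2 p hpS q hqS (hpm.2.trans hqm.2)) ((h1' p hpS).2.trans (h1' q hqS).2.symm)
  have hmono : ∀ u ∈ (S : Set V) \ {x}, ∀ v ∈ (S : Set V) \ {x}, u ≤ v → φ u ≤ φ v := by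
    intro u hu v hv huv
    rcases huv.eq_or_lt with rfl | huv
    · exact le_rfl
    · exact (h2 u hu v hv huv).le
  refine h (copyOn_of_update (x := x) (w := w) φ (fun u hu => (h1' u hu).1) h2 h3 hw ?_ ?_ ?_)
  · intro u hu hux
    refine (hmono u hu p hpS (Finset.le_max' _ _ ?_)).trans_lt hpw
    simpa using ⟨hu.1, hux⟩
  · intro u hu hxu
    refine hwq.trans_le (hmono q hqS u hu (Finset.min'_le _ _ ?_))
    simpa using ⟨hu.1, hxu⟩
  · intro u hu hux
    exact (hiso u hu.1 hux).elim

/-! ### Splitting at a vertex -/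

/-- If no edge of `T[S]` passes over `r`, split `A` into the vertices that play the role of `r` in
a copy of the part of `T[S]` up to `r` and the other vertices. The latter contain no copy of
this left part, and the former contain no copy of the right part. -/
theorem colorableOn_of_split {r : V} (hr : r ∈ S)
    (hcut : ∀ u ∈ S, ∀ v ∈ S, u < r → r < v → ¬ T.Adj u v)
    (ih1 : ∀ B : Finset W, ¬ CopyOn T {v | v ∈ S ∧ v ≤ r} G ↑B → ColorableOn G B m)
    (ih2 : ∀ B : Finset W, ¬ CopyOn T {v | v ∈ S ∧ r ≤ v} G ↑B → ColorableOn G B n)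
    (h : ¬ CopyOn T ↑S G ↑A) : ColorableOn G A (m + n) := by
  classical
  set p : W → Prop := fun w => ∃ φ : V → W, φ r = w ∧ (∀ u ∈ S, u ≤ r → φ u ∈ A) ∧
    (∀ u ∈ S, u ≤ r → ∀ v ∈ S, v ≤ r → u < v → φ u < φ v) ∧
    ∀ u ∈ S, u ≤ r → ∀ v ∈ S, v ≤ r → T.Adj u v → G.Adj (φ u) (φ v) with hp
  have key := colorableOn_add (G := G) (A := A) (m := n) (n := m) p (ih2 _ ?_) (ih1 _ ?_)
  · rwa [Nat.add_comm] at key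
  · rintro ⟨ψ, h1, h2, h3⟩
    have h1' : ∀ u ∈ S, r ≤ u → ψ u ∈ A ∧ p (ψ u) := by simpa using h1
    obtain ⟨φ, hφr, g1, g2, g3⟩ := (h1' r hr le_rfl).2
    refine h ⟨fun v => if v ≤ r then φ v else ψ v, ?_, ?_, ?_⟩
    · intro u hu
      by_cases hur : u ≤ r
      · simpa [hur] using g1 u hu hur
      · simpa [hur] using (h1' u hu (not_le.1 hur).le).1
    · intro u hu v hv huv
      by_cases hvr : v ≤ r
      · have hur := huv.le.trans hvr
        simpa [hur, hvr] using g2 u hu hur v hv hvr huv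
      · have hrv := not_le.1 hvr
        have hlt : φ r < ψ v := hφr ▸ h2 r ⟨hr, le_rfl⟩ v ⟨hv, hrv.le⟩ hrv
        by_cases hur : u ≤ r
        · simp only [hur, hvr, if_true, if_false]
          rcases hur.eq_or_lt with rfl | hur'
          · exact hlt
          · exact (g2 u hu hur r hr le_rfl hur').trans hlt
        · simpa [hur, hvr] using h2 u ⟨hu, (not_le.1 hur).le⟩ v ⟨hv, hrv.le⟩ huv
    · have aux : ∀ u ∈ S, ∀ v ∈ S, u < v → T.Adj u v →
          G.Adj (if u ≤ r then φ u else ψ u) (if v ≤ r then φ v else ψ v) := by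
        intro u hu v hv huv hadj
        by_cases hvr : v ≤ r
        · have hur := huv.le.trans hvr
          simpa [hur, hvr] using g3 u hu hur v hv hvr hadj
        · have hrv := not_le.1 hvr
          by_cases hur : u ≤ r
          · simp only [hur, hvr, if_true, if_false]
            rcases hur.eq_or_lt with rfl | hur'
            · rw [hφr]
              exact h3 u ⟨hu, le_rfl⟩ v ⟨hv, hrv.le⟩ hadj
            · exact (hcut u hu v hv hur' hrv hadj).elim
          · simpa [hur, hvr] using h3 u ⟨hu, (not_le.1 hur).le⟩ v ⟨hv, hrv.le⟩ hadj
      intro u hu v hv hadj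
      rcases lt_trichotomy u v with huv | rfl | huv
      · exact aux u hu v hv huv hadj
      · exact (T.irrefl hadj).elim
      · exact (aux v hv u hu huv hadj.symm).symm
  · rintro ⟨φ, h1, h2, h3⟩
    have h1' : ∀ u ∈ S, u ≤ r → φ u ∈ A ∧ ¬ p (φ u) := by simpa using h1
    exact (h1' r hr le_rfl).2 ⟨φ, rfl, fun u hu hur => (h1' u hu hur).1,
      fun u hu hur v hv hvr => h2 u ⟨hu, hur⟩ v ⟨hv, hvr⟩,
      fun u hu hur v hv hvr => h3 u ⟨hu, hur⟩ v ⟨hv, hvr⟩⟩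

/-! ### Wrapping an edge around an ordered graph -/

/-- Cutting `A` greedily into consecutive intervals without a copy, so that two
consecutive intervals together contain a copy; `g x` is the index of the interval of `x`. -/
theorem exists_greedy_intervals {Q : Set V} (hQ : Q.Nontrivial) (A : Finset W) :
    ∃ g : W → ℕ, (∀ x ∈ A, ∀ y ∈ A, x ≤ y → g x ≤ g y) ∧
      (∀ i, ¬ CopyOn T Q G ↑(A.filter fun x => g x = i)) ∧
      (∀ x ∈ A, ∀ i ≤ g x, ∃ y ∈ A, g y = i) ∧
      ∀ i, (∃ y ∈ A, g y = i + 1) → CopyOn T Q G {z | z ∈ A ∧ (g z = i ∨ g z = i + 1)} := by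
  classical
  induction A using Finset.induction_on_max with
  | empty =>
    obtain ⟨u, hu, -⟩ := hQ
    refine ⟨fun _ => 0, by simp, ?_, by simp, by simp⟩
    rintro i ⟨φ, h1, -⟩
    simpa using h1 u hu
  | insert m A hm ih =>
    obtain ⟨g, h1, h2, h3, h4⟩ := ih
    have hmA : m ∉ A := fun h => (hm m h).false
    -- a single vertex contains no copy, as `Q` has two elements
    have hsingle : ∀ B : Set W, B ⊆ {m} → ¬ CopyOn T Q G B := by
      rintro B hB ⟨φ, f1, f2, -⟩
      obtain ⟨u, hu, v, hv, huv⟩ := hQ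
      have e1 : φ u = m := hB (f1 u hu)
      have e2 : φ v = m := hB (f1 v hv)
      rcases lt_or_gt_of_ne huv with h | h
      · exact (f2 u hu v hv h).ne (e1.trans e2.symm)
      · exact (f2 v hv u hu h).ne (e2.trans e1.symm)
    have hupd : ∀ t, ∀ x ∈ A, Function.update g m t x = g x := fun t x hx =>
      Function.update_of_ne (fun h : x = m => hmA (h ▸ hx)) _ _
    have hlev : ∀ t i, i ≠ t → (insert m A).filter (fun x => Function.update g m t x = i) =
        A.filter fun x => g x = i := by
      intro t i hi
      ext x
      by_cases hx : x = m
      · subst hx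
        simp [hi.symm, hmA]
      · simp [hx]
    have hlev' : ∀ t, (insert m A).filter (fun x => Function.update g m t x = t) =
        insert m (A.filter fun x => g x = t) := by
      intro t
      ext x
      by_cases hx : x = m
      · subst hx
        simp
      · simp [hx]
    -- the conditions for the extension of `g` by `g m = t`
    have fin : ∀ t, (∀ x ∈ A, g x ≤ t) → (∀ i < t, ∃ y ∈ A, g y = i) →
        ¬ CopyOn T Q G ↑(insert m (A.filter fun x => g x = t)) →
        (∀ i, i + 1 = t → CopyOn T Q G {z | z ∈ insert m A ∧
          (Function.update g m t z = i ∨ Function.update g m t z = i + 1)}) →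
        ∃ g : W → ℕ, (∀ x ∈ insert m A, ∀ y ∈ insert m A, x ≤ y → g x ≤ g y) ∧
        (∀ i, ¬ CopyOn T Q G ↑((insert m A).filter fun x => g x = i)) ∧
        (∀ x ∈ insert m A, ∀ i ≤ g x, ∃ y ∈ insert m A, g y = i) ∧
        ∀ i, (∃ y ∈ insert m A, g y = i + 1) →
          CopyOn T Q G {z | z ∈ insert m A ∧ (g z = i ∨ g z = i + 1)} := by
      intro t ht hall hfree hcopy
      refine ⟨Function.update g m t, ?_, ?_, ?_, ?_⟩
      · intro x hx y hy hxy
        rcases Finset.mem_insert.1 hy with hym | hyA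
        · rcases Finset.mem_insert.1 hx with hxm | hxA
          · rw [hxm, hym]
          · simpa [hym, hupd t x hxA] using ht x hxA
        · rcases Finset.mem_insert.1 hx with hxm | hxA
          · exact absurd (hxm ▸ hm y hyA) hxy.not_gt
          · simpa [hupd t x hxA, hupd t y hyA] using h1 x hxA y hyA hxy
      · intro i
        by_cases hi : i = t
        · subst hi
          rwa [hlev']
        · rw [hlev t i hi]
          exact h2 i
      · intro x hx i hi
        have hit : i ≤ t := by
          rcases Finset.mem_insert.1 hx with rfl | hx
          · simpa using hi
          · rw [hupd t x hx] at hi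
            exact hi.trans (ht x hx)
        rcases hit.eq_or_lt with rfl | hit
        · exact ⟨m, by simp, by simp⟩
        · obtain ⟨y, hy, hyi⟩ := hall i hit
          exact ⟨y, by simp [hy], by rw [hupd t y hy, hyi]⟩
      · rintro i ⟨y, hy, hyi⟩
        by_cases hi : i + 1 = t
        · exact hcopy i hi
        · have hyA : y ∈ A := by
            rcases Finset.mem_insert.1 hy with rfl | hy
            · simp only [Function.update_self] at hyi
              exact absurd hyi.symm hi
            · exact hy
          rw [hupd t y hyA] at hyi
          refine (h4 i ⟨y, hyA, hyi⟩).mono ?_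
          rintro z ⟨hz, hzi⟩
          refine ⟨by simp [hz], ?_⟩
          rwa [hupd t z hz]
    rcases A.eq_empty_or_nonempty with rfl | hA
    · refine fin 0 (by simp) (by simp) (hsingle _ (by simp)) (by simp)
    set M := A.max' hA with hM
    have hMA : M ∈ A := A.max'_mem hA
    have hgM : ∀ x ∈ A, g x ≤ g M := fun x hx => h1 x hx M hMA (A.le_max' x hx)
    by_cases hfree : CopyOn T Q G ↑(insert m (A.filter fun x => g x = g M))
    · refine fin (g M + 1) (fun x hx => (hgM x hx).trans (Nat.le_succ _))
        (fun i hi => h3 M hMA i (Nat.lt_succ_iff.1 hi)) (hsingle _ ?_) ?_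
      · intro x hx
        simp only [Finset.coe_insert, Set.mem_insert_iff, Finset.mem_coe, Finset.mem_filter] at hx
        rcases hx with rfl | ⟨hx, hgx⟩
        · rfl
        · have := hgM x hx
          omega
      · intro i hi
        refine hfree.mono ?_
        intro x hx
        simp only [Finset.coe_insert, Set.mem_insert_iff, Finset.mem_coe, Finset.mem_filter] at hx
        rcases hx with rfl | ⟨hx, hgx⟩
        · exact ⟨by simp, Or.inr (by simp [hi])⟩
        · exact ⟨by simp [hx], Or.inl (by rw [hupd _ x hx]; omega)⟩
    · refine fin (g M) hgM (fun i hi => h3 M hMA i hi.le) hfree ?_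
      intro i hi
      refine (h4 i ⟨M, hMA, hi.symm⟩).mono ?_
      rintro z ⟨hz, hzi⟩
      exact ⟨by simp [hz], by rwa [hupd _ z hz]⟩

/-- If the leftmost vertex `l` and the rightmost vertex `r` are adjacent to each other and to
nothing else, then no edge of `G` spans a copy of the rest. Hence an edge can only join two
greedy intervals that are at most two apart, and taking the index modulo three separates them. -/
theorem colorableOn_of_wrap {l r : V} (hlr : l < r) (hl : ∀ v ∈ S, l ≤ v) (hr : ∀ v ∈ S, v ≤ r)
    (hlS : ∀ v ∈ S, T.Adj l v → v = r) (hrS : ∀ v ∈ S, T.Adj r v → v = l)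
    (hQ : ((S : Set V) \ {l, r}).Nontrivial)
    (ih : ∀ B : Finset W, ¬ CopyOn T (↑S \ {l, r}) G ↑B → ColorableOn G B n)
    (h : ¬ CopyOn T ↑S G ↑A) : ColorableOn G A (3 * n) := by
  classical
  obtain ⟨g, h1, h2, h3, h4⟩ := exists_greedy_intervals (T := T) (G := G) hQ A
  have key : ∀ x ∈ A, ∀ y ∈ A, G.Adj x y → g x + 3 ≤ g y → False := by
    intro x hx y hy hxy hg
    obtain ⟨φ, f1, f2, f3⟩ := h4 (g x + 1) (h3 y hy _ (by omega))
    have hbet : ∀ u ∈ (S : Set V) \ {l, r}, x < φ u ∧ φ u < y := by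
      intro u hu
      obtain ⟨hA, hgu⟩ := f1 u hu
      constructor
      · by_contra! hle
        have := h1 _ hA x hx hle
        omega
      · by_contra! hle
        have := h1 y hy _ hA hle
        omega
    have hmem : ∀ u ∈ S, u ≠ l → u ≠ r → u ∈ (S : Set V) \ {l, r} := by
      intro u hu hul hur
      simp [hu, hul, hur]
    refine h ⟨fun v => if v = l then x else if v = r then y else φ v, ?_, ?_, ?_⟩
    · intro u hu
      by_cases hul : u = l
      · simpa [hul] using hx
      by_cases hur : u = r
      · simpa [hur, hlr.ne'] using hy
      simpa [hul, hur] using (f1 u (hmem u hu hul hur)).1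
    · have hxy' : x < y := by
        by_contra! hle
        have := h1 y hy x hx hle
        omega
      intro u hu v hv huv
      have hvl : v ≠ l := fun e => (hl u hu).not_gt (e ▸ huv)
      have hur : u ≠ r := fun e => (hr v hv).not_gt (e ▸ huv)
      by_cases hul : u = l <;> by_cases hvr : v = r
      · simpa [hul, hvr, hlr.ne'] using hxy'
      · simpa [hul, hvr, hvl] using (hbet v (hmem v hv hvl hvr)).1
      · simpa [hul, hvr, hlr.ne', hur] using (hbet u (hmem u hu hul hur)).2
      · simpa [hul, hvr, hur, hvl] using f2 u (hmem u hu hul hur) v (hmem v hv hvl hvr) huv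
    · intro u hu v hv huv
      by_cases hul : u = l
      · subst hul
        obtain rfl := hlS v hv huv
        simpa [hlr.ne'] using hxy
      by_cases hvl : v = l
      · subst hvl
        obtain rfl := hlS u hu huv.symm
        simpa [hlr.ne'] using hxy.symm
      by_cases hur : u = r
      · subst hur
        exact (hvl (hrS v hv huv)).elim
      by_cases hvr : v = r
      · subst hvr
        exact (hul (hrS u hu huv.symm)).elim
      simpa [hul, hur, hvl, hvr] using f3 u (hmem u hu hul hur) v (hmem v hv hvl hvr) huv
  refine colorableOn_mul g (fun x => g x % 3) (fun x _ => Nat.mod_lt _ (by omega)) ?_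
    fun i => ih _ (h2 i)
  intro x hx y hy hxy hne heq
  rcases lt_or_gt_of_ne hne with hlt | hlt
  · exact key x hx y hy hxy (by omega)
  · exact key y hy x hx hxy.symm (by omega)

end Reductions

/-! ### Forks: bonnets and their degenerate case, the triangle -/

section Forks

variable {V W : Type*} [LinearOrder V] [LinearOrder W]

/-- `T` contains the first kind of bonnet, or the triangle that the same inequalities allow
(`u₂ = u₃` and `u₄ = u₅`): a vertex with two right neighbours that enclose an edge. -/
def HasRightFork (T : SimpleGraph V) : Prop :=
  ∃ u₁ u₂ u₃ u₄ u₅ : V, u₁ < u₂ ∧ u₂ ≤ u₃ ∧ u₃ < u₄ ∧ u₄ ≤ u₅ ∧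
    T.Adj u₁ u₂ ∧ T.Adj u₁ u₅ ∧ T.Adj u₃ u₄

/-- The mirror image of `HasRightFork`: a vertex with two left neighbours that enclose an edge. -/
def HasLeftFork (T : SimpleGraph V) : Prop :=
  ∃ u₁ u₂ u₃ u₄ u₅ : V, u₁ ≤ u₂ ∧ u₂ < u₃ ∧ u₃ ≤ u₄ ∧ u₄ < u₅ ∧
    T.Adj u₁ u₅ ∧ T.Adj u₄ u₅ ∧ T.Adj u₂ u₃

theorem hasRightFork_dual {T : SimpleGraph V} (h : @HasRightFork Vᵒᵈ _ T) : HasLeftFork T := by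
  obtain ⟨u₁, u₂, u₃, u₄, u₅, h1, h2, h3, h4, h5, h6, h7⟩ := h
  exact ⟨u₅, u₄, u₃, u₂, u₁, h4, h3, h2, h1, h6.symm, h5.symm, h7.symm⟩

theorem isCrossing_dual {T : SimpleGraph V} (h : @IsCrossing Vᵒᵈ _ T) : IsCrossing T := by
  obtain ⟨u, v, u', v', h1, h2, h3, h4, h5⟩ := h
  exact ⟨v', u', v, u, h2.symm, h1.symm, h5, h4, h3⟩

theorem copyOn_dual {T : SimpleGraph V} {S : Set V} {G : SimpleGraph W} {A : Set W}
    (h : CopyOn T S G A) : @CopyOn Vᵒᵈ Wᵒᵈ _ _ T S G A := by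
  obtain ⟨φ, h1, h2, h3⟩ := h
  exact ⟨φ, h1, fun u hu v hv huv => h2 v hv u hu huv, h3⟩

theorem copyOn_of_dual {T : SimpleGraph V} {S : Set V} {G : SimpleGraph W} {A : Set W}
    (h : @CopyOn Vᵒᵈ Wᵒᵈ _ _ T S G A) : CopyOn T S G A := by
  obtain ⟨φ, h1, h2, h3⟩ := h
  exact ⟨φ, h1, fun u hu v hv huv => h2 v hv u hu huv, h3⟩

/-! ### Removing the outermost leaf of a segment -/

/-- In the absence of forks and crossings, if the leftmost vertex `l` of `S` is adjacent to the
rightmost vertex `r` and to a further vertex, then `r` is a leaf, and the rightmost remaining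
vertex is again adjacent to `l`. -/
theorem exists_max_leaf {T : SimpleGraph V} (hc : ¬ IsCrossing T) (hf : ¬ HasRightFork T)
    {S : Finset V} {l r : V} (hlS : l ∈ S) (hl : ∀ v ∈ S, l ≤ v) (hr : ∀ v ∈ S, v ≤ r)
    (hlr : T.Adj l r) (hiso : ∀ v ∈ S, ∃ w ∈ S, T.Adj v w)
    (hex : ∃ v ∈ S, v ≠ r ∧ T.Adj l v) :
    ∃ a ∈ S, l < a ∧ a < r ∧ T.Adj l a ∧ (∀ v ∈ S, v ≠ r → v ≤ a) ∧
      ∀ v ∈ S, T.Adj v r → v = l := by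
  classical
  have hne : (S.filter fun v => v ≠ r ∧ T.Adj l v).Nonempty := by
    obtain ⟨v, hv⟩ := hex
    exact ⟨v, Finset.mem_filter.2 hv⟩
  obtain ⟨haS, har, hla⟩ := Finset.mem_filter.1 (Finset.max'_mem _ hne)
  have hamax : ∀ v ∈ S, v ≠ r → T.Adj l v → v ≤ Finset.max' _ hne := fun v hv hvr hlv =>
    Finset.le_max' _ _ (Finset.mem_filter.2 ⟨hv, hvr, hlv⟩)
  set a := Finset.max' _ hne
  have hla' : l < a := lt_of_le_of_ne (hl a haS) hla.ne
  have har' : a < r := lt_of_le_of_ne (hr a haS) har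
  have hfork : ∀ u ∈ S, ∀ v ∈ S, a ≤ u → a ≤ v → ¬ T.Adj u v := by
    intro u hu v hv hau hav huv
    rcases lt_or_gt_of_ne huv.ne with h | h
    · exact hf ⟨l, a, u, v, r, hla', hau, h, hr v hv, hla, hlr, huv⟩
    · exact hf ⟨l, a, v, u, r, hla', hav, h, hr u hu, hla, hlr, huv.symm⟩
  -- beyond `a` there are no edges except those at `l`
  have hout : ∀ u ∈ S, ∀ v ∈ S, a < v → T.Adj u v → u = l := by
    intro u hu v hv hav huv
    by_contra hul
    have hlu : l < u := lt_of_le_of_ne (hl u hu) (Ne.symm hul)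
    rcases lt_or_ge u a with hua | hua
    · exact hc ⟨l, a, u, v, hla, huv, hlu, hua, hav⟩
    · exact hfork u hu v hv hua hav.le huv
  refine ⟨a, haS, hla', har', hla, fun v hv hvr => ?_, fun v hv hvr => ?_⟩
  · by_contra! hav
    obtain ⟨w, hw, hvw⟩ := hiso v hv
    obtain rfl := hout w hw v hv hav hvw.symm
    exact hav.not_ge (hamax v hv hvr hvw.symm)
  · by_contra hvl
    rcases lt_or_ge v a with hva | hva
    · exact hc ⟨l, a, v, r, hla, hvr, lt_of_le_of_ne (hl v hv) (Ne.symm hvl), hva, har'⟩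
    · exact hf ⟨l, a, v, r, r, hla', hva, lt_of_le_of_ne (hr v hv) hvr.ne, le_rfl, hla, hlr, hvr⟩

/-- `G'` arises from the subgraph of `G` on `A` by deleting edges that are covered by a map `f`
(each is of the form `{x, f x}`) and that together form a `2`-colourable graph. -/
def IsThinning {W : Type*} (G' G : SimpleGraph W) (A : Finset W) : Prop :=
  ∃ f : W → W, ∃ d : W → ℕ, (∀ x ∈ A, d x < 2) ∧ ∀ x ∈ A, ∀ y ∈ A, G.Adj x y →
    G'.Adj x y ∨ ((y = f x ∨ x = f y) ∧ d x ≠ d y)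

theorem IsThinning.colorableOn {W : Type*} {G' G : SimpleGraph W} {A : Finset W} {n : ℕ}
    (h : IsThinning G' G A) (hG' : ColorableOn G' A n) : ColorableOn G A (2 * n) := by
  classical
  obtain ⟨f, d, hd, hadj⟩ := h
  obtain ⟨c, hc, hc'⟩ := hG'
  refine colorableOn_mul d d hd (fun _ _ _ _ _ hne => hne) fun i =>
    ⟨c, fun x hx => hc x (Finset.mem_filter.1 hx).1, fun x hx y hy hxy => ?_⟩
  rw [Finset.mem_filter] at hx hy
  rcases hadj x hx.1 y hy.1 hxy with h | h
  · exact hc' x hx.1 y hy.1 h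
  · exact (h.2 (hx.2.trans hy.2.symm)).elim

open Classical in
theorem IsThinning.adjPairs_le {W : Type*} {G' G : SimpleGraph W} {A : Finset W}
    (h : IsThinning G' G A) :
    ((A ×ˢ A).filter fun p => G.Adj p.1 p.2).card ≤
      ((A ×ˢ A).filter fun p => G'.Adj p.1 p.2).card + 2 * A.card := by
  obtain ⟨f, d, -, hadj⟩ := h
  have hsub : ((A ×ˢ A).filter fun p => G.Adj p.1 p.2) ⊆
      ((A ×ˢ A).filter fun p => G'.Adj p.1 p.2) ∪
        (A.image (fun x => (x, f x)) ∪ A.image fun x => (f x, x)) := by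
    rintro ⟨x, y⟩ hxy
    simp only [Finset.mem_filter, Finset.mem_product] at hxy
    obtain ⟨⟨hx, hy⟩, hxy⟩ := hxy
    rcases hadj x hx y hy hxy with h | ⟨h | h, -⟩
    · exact Finset.mem_union_left _ (by simp [hx, hy, h])
    · exact Finset.mem_union_right _ (Finset.mem_union_left _
        (Finset.mem_image.2 ⟨x, hx, by rw [h]⟩))
    · exact Finset.mem_union_right _ (Finset.mem_union_right _
        (Finset.mem_image.2 ⟨y, hy, by rw [h]⟩))
  have h1 := Finset.card_le_card hsub
  have h2 := Finset.card_union_le ((A ×ˢ A).filter fun p => G'.Adj p.1 p.2)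
    (A.image (fun x => (x, f x)) ∪ A.image fun x => (f x, x))
  have h3 := Finset.card_union_le (A.image fun x => (x, f x)) (A.image fun x => (f x, x))
  have h4 := Finset.card_image_le (s := A) (f := fun x => (x, f x))
  have h5 := Finset.card_image_le (s := A) (f := fun x => (f x, x))
  omega

/-- Deleting, for each vertex, the edge to its farthest right neighbour. -/
theorem exists_farthest_thinning (G : SimpleGraph W) (A : Finset W) :
    ∃ G' ≤ G, IsThinning G' G A ∧
      ∀ x ∈ A, ∀ y ∈ A, x < y → G'.Adj x y → ∃ z ∈ A, y < z ∧ G.Adj x z := by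
  classical
  set N : W → Finset W := fun x => A.filter fun y => x < y ∧ G.Adj x y with hN
  set f : W → W := fun x => if h : (N x).Nonempty then (N x).max' h else x with hf
  have hfar : ∀ x, ∀ y ∈ A, x < y → G.Adj x y → f x ∈ A ∧ y ≤ f x ∧ G.Adj x (f x) := by
    intro x y hy hxy hadj
    have hmem : y ∈ N x := Finset.mem_filter.2 ⟨hy, hxy, hadj⟩
    have hne : (N x).Nonempty := ⟨y, hmem⟩
    have hfx : f x = (N x).max' hne := dif_pos hne
    have := Finset.mem_filter.1 ((N x).max'_mem hne)
    rw [hfx]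
    exact ⟨this.1, Finset.le_max' _ _ hmem, this.2.2⟩
  obtain ⟨H, hH⟩ : ∃ H : SimpleGraph W, ∀ x y, H.Adj x y ↔
      x ≠ y ∧ ((x < y ∧ y = f x) ∨ (y < x ∧ x = f y)) :=
    ⟨SimpleGraph.fromRel fun x y => x < y ∧ y = f x, fun _ _ => Iff.rfl⟩
  obtain ⟨d, hd, hd'⟩ : ColorableOn H A 2 := by
    refine colorableOn_of_degenerate (d := 1) fun B _ hB => ⟨B.min' hB, B.min'_mem hB, ?_⟩
    refine (Finset.card_le_card (t := {f (B.min' hB)}) fun y hy => ?_).trans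
      (Finset.card_singleton _).le
    rw [Finset.mem_filter, hH] at hy
    obtain ⟨hyB, -, h | h⟩ := hy
    · exact Finset.mem_singleton.2 h.2
    · exact absurd (B.min'_le y hyB) h.1.not_ge
  refine ⟨G \ H, sdiff_le, ⟨f, d, hd, fun x hx y hy hxy => ?_⟩, fun x hx y hy hxy hadj => ?_⟩
  · by_cases hHxy : H.Adj x y
    · refine Or.inr ⟨?_, hd' x hx y hy hHxy⟩
      obtain ⟨-, h | h⟩ := (hH x y).1 hHxy
      · exact Or.inl h.2
      · exact Or.inr h.2
    · exact Or.inl ⟨hxy, hHxy⟩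
  · obtain ⟨h1, h2, h3⟩ := hfar x y hy hxy hadj.1
    exact ⟨f x, h1, lt_of_le_of_ne h2 fun he =>
      hadj.2 ((hH x y).2 ⟨hxy.ne, Or.inl ⟨hxy, he⟩⟩), h3⟩

/-- A copy of `T[S \ {r}]` that uses no edge to a farthest right neighbour extends to a copy of
`T[S]`, the role of the new rightmost vertex `r` being played by a farthest neighbour. -/
theorem exists_thinning_of_max_leaf {T : SimpleGraph V} {S : Finset V} {l a r : V} (hl : l ∈ S)
    (ha : a ∈ S) (hla : l < a) (har : a < r) (hadj : T.Adj l a)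
    (hmax : ∀ v ∈ S, v ≠ r → v ≤ a) (hleaf : ∀ v ∈ S, T.Adj v r → v = l)
    {G : SimpleGraph W} {A : Finset W} (h : ¬ CopyOn T ↑S G ↑A) :
    ∃ G', IsThinning G' G A ∧ ¬ CopyOn T (↑S \ {r}) G' ↑A := by
  classical
  obtain ⟨G', hle, hthin, hfar⟩ := exists_farthest_thinning G A
  refine ⟨G', hthin, ?_⟩
  rintro ⟨φ, h1, h2, h3⟩
  have hlS : l ∈ (S : Set V) \ {r} := ⟨hl, (hla.trans har).ne⟩
  have haS : a ∈ (S : Set V) \ {r} := ⟨ha, har.ne⟩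
  obtain ⟨z, hz, haz, hlz⟩ := hfar _ (h1 l hlS) _ (h1 a haS) (h2 l hlS a haS hla)
    (h3 l hlS a haS hadj)
  refine h (copyOn_of_update (x := r) φ h1 h2 (fun u hu v hv huv => hle (h3 u hu v hv huv)) hz
    ?_ ?_ ?_)
  · intro u hu _
    rcases (hmax u hu.1 hu.2).eq_or_lt with rfl | hua
    · exact haz
    · exact (h2 u hu a haS hua).trans haz
  · intro u hu hru
    exact absurd (hmax u hu.1 hu.2) (har.trans hru).not_ge
  · intro u hu hur
    rw [hleaf u hu.1 hur]
    exact hlz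

/-- Peeling a segment, that is, a vertex set whose extremal vertices are adjacent: one of the
two is a leaf `x` whose removal leaves a segment, and the graphs without a copy of `T[S]` have
thinnings without a copy of `T[S \ {x}]`. -/
theorem exists_peeling {T : SimpleGraph V} (hc : ¬ IsCrossing T) (hf : ¬ HasRightFork T)
    (hf' : ¬ HasLeftFork T) {S : Finset V} {l r : V} (hlS : l ∈ S) (hrS : r ∈ S)
    (hl : ∀ v ∈ S, l ≤ v) (hr : ∀ v ∈ S, v ≤ r) (hlr : T.Adj l r)
    (hiso : ∀ v ∈ S, ∃ w ∈ S, T.Adj v w)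
    (hex : ∃ v ∈ S, (v ≠ r ∧ T.Adj l v) ∨ (v ≠ l ∧ T.Adj r v)) :
    ∃ x l' r' p, x ∈ S ∧ l' ∈ S ∧ r' ∈ S ∧ l' ≠ x ∧ r' ≠ x ∧
      (∀ v ∈ S, v ≠ x → l' ≤ v ∧ v ≤ r') ∧ T.Adj l' r' ∧
      (∀ v ∈ S, T.Adj v x → v = p) ∧
      ∀ (G : SimpleGraph W) (A : Finset W), ¬ CopyOn T ↑S G ↑A →
        ∃ G', IsThinning G' G A ∧ ¬ CopyOn T (↑S \ {x}) G' ↑A := by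
  obtain ⟨v, hv, h | h⟩ := hex
  · obtain ⟨a, ha, hla, har, hadj, hmax, hleaf⟩ :=
      exists_max_leaf hc hf hlS hl hr hlr hiso ⟨v, hv, h⟩
    exact ⟨r, l, a, l, hrS, hlS, ha, (hla.trans har).ne, har.ne,
      fun v hv hvr => ⟨hl v hv, hmax v hv hvr⟩, hadj, hleaf,
      fun G A hcopy => exists_thinning_of_max_leaf hlS ha hla har hadj hmax hleaf hcopy⟩
  · -- the mirror image of the first case
    obtain ⟨a, ha, hra, hal, hadj, hmin, hleaf⟩ :=
      @exists_max_leaf Vᵒᵈ _ T (fun h => hc (isCrossing_dual h))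
        (fun h => hf' (hasRightFork_dual h)) S r l hrS hr hl hlr.symm hiso ⟨v, hv, h⟩
    refine ⟨l, a, r, r, hlS, ha, hrS, ?_, ?_, fun v hv hvl => ⟨hmin v hv hvl, hr v hv⟩,
      hadj.symm, hleaf, fun G A hcopy => ?_⟩
    · exact LT.lt.ne' (α := V) hal
    · exact hlr.ne'
    · obtain ⟨G', h1, h2⟩ := @exists_thinning_of_max_leaf Vᵒᵈ Wᵒᵈ _ _ T S r a l hrS ha hra hal hadj
        hmin hleaf G A fun h => hcopy (copyOn_of_dual h)
      exact ⟨G', h1, fun h => h2 (copyOn_dual (V := V) (W := W) h)⟩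

end Forks

/-! ### Upper bounds for graphs without a copy -/

section UpperBounds

variable {V W : Type*} [LinearOrder V] [LinearOrder W]
variable {T : SimpleGraph V} {S : Finset V}

/-- The farthest neighbour `r` of the leftmost vertex of a non-crossing ordered graph is a place
to cut: no edge passes over `r`. -/
theorem not_adj_across_farthest (hc : ¬ IsCrossing T) {l r : V} (hl : ∀ v ∈ S, l ≤ v)
    (hlr : T.Adj l r) (hmax : ∀ v ∈ S, T.Adj l v → v ≤ r) :
    ∀ u ∈ S, ∀ v ∈ S, u < r → r < v → ¬ T.Adj u v := by
  intro u hu v hv hur hrv huv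
  rcases (hl u hu).eq_or_lt with rfl | hlu
  · exact hrv.not_ge (hmax v hv huv)
  · exact hc ⟨l, r, u, v, hlr, huv, hlu, hur, hrv⟩

theorem edgeless_of_not_copyOn_pair {l r : V} (hlr : l < r) (hS : ∀ v ∈ S, v = l ∨ v = r)
    {G : SimpleGraph W} {A : Finset W} (h : ¬ CopyOn T ↑S G ↑A) :
    ∀ x ∈ A, ∀ y ∈ A, ¬ G.Adj x y := by
  classical
  have key : ∀ x ∈ A, ∀ y ∈ A, x < y → ¬ G.Adj x y := by
    intro x hx y hy hlt hxy
    refine h ⟨fun v => if v = l then x else y, ?_, ?_, ?_⟩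
    · intro u _
      by_cases hu : u = l
      · simpa [hu] using hx
      · simpa [hu] using hy
    · intro u hu v hv huv
      rcases hS u hu with rfl | rfl <;> rcases hS v hv with rfl | rfl
      · exact (huv.false).elim
      · simpa [hlr.ne'] using hlt
      · exact (huv.asymm hlr).elim
      · exact (huv.false).elim
    · intro u hu v hv huv
      rcases hS u hu with rfl | rfl <;> rcases hS v hv with rfl | rfl
      · exact (T.irrefl huv).elim
      · simpa [hlr.ne'] using hxy
      · simpa [hlr.ne'] using hxy.symm
      · exact (T.irrefl huv).elim
  intro x hx y hy hxy
  rcases lt_or_gt_of_ne hxy.ne with hlt | hlt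
  · exact key x hx y hy hlt hxy
  · exact key y hy x hx hlt hxy.symm

theorem colorableOn_two_pow (hc : ¬ IsCrossing T) (hf : ¬ HasRightFork T) (hf' : ¬ HasLeftFork T)
    (S : Finset V) (G : SimpleGraph W) (A : Finset W) (h : ¬ CopyOn T ↑S G ↑A) :
    ColorableOn G A (2 ^ S.card) := by
  classical
  induction S using Finset.strongInduction generalizing G A with
  | H S ih =>
    rcases S.eq_empty_or_nonempty with rfl | hS
    · rcases A.eq_empty_or_nonempty with rfl | ⟨a, ha⟩
      · exact colorableOn_empty
      · exact (h ⟨fun _ => a, by simp, by simp, by simp⟩).elim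
    have ih_erase : ∀ x ∈ S, ∀ (G : SimpleGraph W) (B : Finset W),
        ¬ CopyOn T (↑S \ {x}) G ↑B → ColorableOn G B (2 ^ (S.card - 1)) := by
      intro x hx G B hB
      rw [← Finset.coe_erase] at hB
      have := ih (S.erase x) (Finset.erase_ssubset hx) G B hB
      rwa [Finset.card_erase_of_mem hx] at this
    obtain ⟨k, hk⟩ : ∃ k, S.card = k + 1 := ⟨S.card - 1, by have := hS.card_pos; omega⟩
    rw [hk, Nat.add_sub_cancel] at ih_erase
    rw [hk, pow_succ']
    set l := S.min' hS
    have hlS : l ∈ S := S.min'_mem hS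
    have hl : ∀ v ∈ S, l ≤ v := fun v hv => S.min'_le v hv
    by_cases hliso : ∀ v ∈ S, ¬ T.Adj v l
    · have := colorableOn_of_isolated_min hl hliso (ih_erase l hlS G) h
      have hpos : 0 < 2 ^ k := by positivity
      exact this.mono (by omega)
    push Not at hliso
    obtain ⟨s, hs, hsl⟩ := hliso
    have hN : (S.filter fun v => T.Adj l v).Nonempty := ⟨s, by simp [hs, hsl.symm]⟩
    obtain ⟨hrS, hlr⟩ := Finset.mem_filter.1 (Finset.max'_mem _ hN)
    have hmax : ∀ v ∈ S, T.Adj l v → v ≤ Finset.max' _ hN := fun v hv hlv =>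
      Finset.le_max' _ _ (Finset.mem_filter.2 ⟨hv, hlv⟩)
    set r := Finset.max' _ hN
    have hlr' : l < r := lt_of_le_of_ne (hl r hrS) hlr.ne
    by_cases hbeyond : ∃ t ∈ S, r < t
    · obtain ⟨t, ht, hrt⟩ := hbeyond
      have hsub1 : S.filter (· ≤ r) ⊂ S :=
        Finset.filter_ssubset.2 ⟨t, ht, hrt.not_ge⟩
      have hsub2 : S.filter (r ≤ ·) ⊂ S :=
        Finset.filter_ssubset.2 ⟨l, hlS, hlr'.not_ge⟩
      have hpow : ∀ S' ⊂ S, 2 ^ S'.card ≤ 2 ^ k := fun S' hS' =>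
        Nat.pow_le_pow_right two_pos (by have := Finset.card_lt_card hS'; omega)
      have := colorableOn_of_split hrS (not_adj_across_farthest hc hl hlr hmax)
        (fun B hB => (ih _ hsub1 G B (by simpa using hB)).mono (hpow _ hsub1))
        (fun B hB => (ih _ hsub2 G B (by simpa using hB)).mono (hpow _ hsub2)) h
      exact this.mono (by omega)
    push Not at hbeyond
    by_cases hiso : ∀ v ∈ S, ∃ w ∈ S, T.Adj v w
    swap
    · push Not at hiso
      obtain ⟨x, hx, hxiso⟩ := hiso
      have hxl : x ≠ l := fun e => hxiso r hrS (e ▸ hlr)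
      have hxr : x ≠ r := fun e => hxiso l hlS (e ▸ hlr.symm)
      exact colorableOn_of_isolated_between hlS hrS (lt_of_le_of_ne (hl x hx) hxl.symm)
        (lt_of_le_of_ne (hbeyond x hx) hxr) (fun v hv hvx => hxiso v hv hvx.symm)
        (ih_erase x hx G) h
    by_cases hex : ∃ v ∈ S, (v ≠ r ∧ T.Adj l v) ∨ (v ≠ l ∧ T.Adj r v)
    · obtain ⟨x, -, -, -, hx, -, -, -, -, -, -, -, hpeel⟩ :=
        exists_peeling (W := W) hc hf hf' hlS hrS hl hbeyond hlr hiso hex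
      obtain ⟨G', hthin, hG'⟩ := hpeel G A h
      exact hthin.colorableOn (ih_erase x hx G' A hG')
    push Not at hex
    by_cases hpair : ∀ v ∈ S, v = l ∨ v = r
    · have hpos : 0 < 2 ^ k := by positivity
      exact (colorableOn_of_edgeless (edgeless_of_not_copyOn_pair hlr' hpair h)).mono (by omega)
    push Not at hpair
    obtain ⟨q, hq, hql, hqr⟩ := hpair
    have hlonly : ∀ v ∈ S, T.Adj l v → v = r := fun v hv hlv => by
      by_contra hne
      exact (hex v hv).1 hne hlv
    have hronly : ∀ v ∈ S, T.Adj r v → v = l := fun v hv hrv => by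
      by_contra hne
      exact (hex v hv).2 hne hrv
    obtain ⟨w, hw, hqw⟩ := hiso q hq
    have hwl : w ≠ l := fun e => hqr (hlonly q hq (e ▸ hqw.symm))
    have hwr : w ≠ r := fun e => hql (hronly q hq (e ▸ hqw.symm))
    have hcard : ((S.erase l).erase r).card = k - 1 := by
      rw [Finset.card_erase_of_mem (by simp [hrS, hlr'.ne']), Finset.card_erase_of_mem hlS, hk]
      omega
    have hsub : (S.erase l).erase r ⊂ S :=
      (Finset.erase_subset _ _).trans_ssubset (Finset.erase_ssubset hlS)
    have hwrap := colorableOn_of_wrap hlr' hl hbeyond hlonly hronly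
      ⟨q, by simp [hq, hql, hqr], w, by simp [hw, hwl, hwr], hqw.ne⟩
      (fun B hB => ih _ hsub G B (by
        rwa [Finset.coe_erase, Finset.coe_erase, Set.sdiff_sdiff, Set.singleton_union])) h
    refine hwrap.mono ?_
    have hk1 : 1 ≤ k := by
      have := Finset.card_lt_card (show ({l} : Finset V) ⊂ S from
        Finset.ssubset_iff_subset_ne.2 ⟨by simpa using hlS, fun e => hql (by simpa [← e] using hq)⟩)
      simp only [Finset.card_singleton] at this
      omega
    obtain ⟨j, rfl⟩ : ∃ j, k = j + 1 := ⟨k - 1, by omega⟩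
    rw [hcard, Nat.add_sub_cancel, pow_succ]
    omega

/-- `T[S]` is connected, expressed by cuts: some edge leaves each nonempty proper subset. -/
def ConnectedOn (T : SimpleGraph V) (S : Finset V) : Prop :=
  ∀ B ⊆ S, B.Nonempty → B ≠ S → ∃ b ∈ B, ∃ c ∈ S, c ∉ B ∧ T.Adj b c

theorem connectedOn_univ [Fintype V] (h : T.Connected) : ConnectedOn T Finset.univ := by
  rintro B - ⟨b, hb⟩ hB
  obtain ⟨c, hc⟩ : ∃ c, c ∉ B := by
    by_contra! hall
    exact hB (Finset.eq_univ_iff_forall.2 hall)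
  obtain ⟨p⟩ := h.preconnected b c
  obtain ⟨d, -, hd, hd'⟩ := p.exists_boundary_dart (↑B) (by simpa using hb) (by simpa using hc)
  exact ⟨d.fst, by simpa using hd, d.snd, Finset.mem_univ _, by simpa using hd', d.adj⟩

theorem ConnectedOn.exists_adj {V : Type*} {T : SimpleGraph V} {S : Finset V}
    (h : ConnectedOn T S) (hS : 2 ≤ S.card) :
    ∀ v ∈ S, ∃ w ∈ S, T.Adj v w := by
  intro v hv
  obtain ⟨b, hb, c, hc, -, hbc⟩ := h {v} (by simpa using hv) (by simp) (by
    rintro rfl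
    simp at hS)
  rw [Finset.mem_singleton] at hb
  exact ⟨c, hc, hb ▸ hbc⟩

theorem ConnectedOn.erase_leaf (h : ConnectedOn T S) {x p : V} (hx : x ∈ S)
    (hleaf : ∀ v ∈ S, T.Adj v x → v = p) : ConnectedOn T (S.erase x) := by
  intro B hB hne hBS
  have hxB : x ∉ B := fun hxB => (Finset.mem_erase.1 (hB hxB)).1 rfl
  have hBS' : B ⊆ S := hB.trans (Finset.erase_subset _ _)
  by_cases hp : p ∈ B
  · obtain ⟨b, hb, c, hc, hcB, hbc⟩ := h (insert x B) (Finset.insert_subset hx hBS')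
      (Finset.insert_nonempty _ _) (by
        rintro rfl
        exact hBS (Finset.erase_insert hxB).symm)
    rw [Finset.mem_insert, not_or] at hcB
    rcases Finset.mem_insert.1 hb with rfl | hb
    · exact (hcB.2 (hleaf c hc hbc.symm ▸ hp)).elim
    · exact ⟨b, hb, c, Finset.mem_erase.2 ⟨hcB.1, hc⟩, hcB.2, hbc⟩
  · obtain ⟨b, hb, c, hc, hcB, hbc⟩ := h B hBS' hne (by
      rintro rfl
      exact hxB hx)
    refine ⟨b, hb, c, Finset.mem_erase.2 ⟨?_, hc⟩, hcB, hbc⟩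
    rintro rfl
    exact hp (hleaf b (hBS' hb) hbc ▸ hb)

/-- If no edge of `T[S]` joins `L \ {r}` to `S \ L`, then `L` inherits connectedness from `S`. -/
theorem ConnectedOn.of_cut (h : ConnectedOn T S) {L : Finset V} {r : V} (hL : L ⊆ S)
    (hcut : ∀ u ∈ L, u ≠ r → ∀ v ∈ S, v ∉ L → ¬ T.Adj u v) : ConnectedOn T L := by
  classical
  intro B hB hne hBL
  obtain ⟨t, htL, htB⟩ : ∃ t ∈ L, t ∉ B := by
    by_contra! hall
    exact hBL (hB.antisymm hall)
  by_cases hrB : r ∈ B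
  · obtain ⟨b, hb, c, hc, hcB, hbc⟩ := h (B ∪ S \ L)
      (Finset.union_subset (hB.trans hL) Finset.sdiff_subset) ⟨r, by simp [hrB]⟩ (by
        intro he
        have : t ∈ B ∪ S \ L := by
          rw [he]
          exact hL htL
        simp [htL, htB] at this)
    simp only [Finset.mem_union, Finset.mem_sdiff, not_or, not_and, not_not] at hb hcB
    have hcL := hcB.2 hc
    rcases hb with hb | hb
    · exact ⟨b, hb, c, hcL, hcB.1, hbc⟩
    · exact (hcut c hcL (fun e => hcB.1 (e ▸ hrB)) b hb.1 hb.2 hbc.symm).elim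
  · obtain ⟨b, hb, c, hc, hcB, hbc⟩ := h B (hB.trans hL) hne (by
      rintro rfl
      exact htB (hL htL))
    refine ⟨b, hb, c, ?_, hcB, hbc⟩
    by_contra hcL
    exact hcut b (hB hb) (fun e => hrB (e ▸ hb)) c hc hcL hbc

open Classical in
/-- For a connected segment on `n + 2` vertices, the graphs without a copy have at most `n` edges
per vertex: each peeled vertex accounts for one edge per vertex. The left-hand side counts every
edge twice. -/
theorem adjPairs_le_of_segment (hc : ¬ IsCrossing T) (hf : ¬ HasRightFork T)
    (hf' : ¬ HasLeftFork T) {n : ℕ} {S : Finset V} (hn : S.card = n + 2)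
    (hconn : ConnectedOn T S) {l r : V} (hlS : l ∈ S) (hrS : r ∈ S) (hl : ∀ v ∈ S, l ≤ v)
    (hr : ∀ v ∈ S, v ≤ r) (hlr : T.Adj l r) (G : SimpleGraph W) (A : Finset W)
    (h : ¬ CopyOn T ↑S G ↑A) :
    ((A ×ˢ A).filter fun p => G.Adj p.1 p.2).card ≤ 2 * n * A.card := by
  have hlr' : l < r := lt_of_le_of_ne (hl r hrS) hlr.ne
  have hpairsub : ({l, r} : Finset V) ⊆ S := by
    intro v hv
    rcases Finset.mem_insert.1 hv with rfl | hv
    · exact hlS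
    · rwa [Finset.mem_singleton.1 hv]
  have hpaircard : ({l, r} : Finset V).card = 2 := Finset.card_pair hlr'.ne
  induction n generalizing S l r G with
  | zero =>
    have hS : ({l, r} : Finset V) = S := Finset.eq_of_subset_of_card_le hpairsub (by omega)
    have hno := edgeless_of_not_copyOn_pair hlr' (fun v hv => by simpa [← hS] using hv) h
    rw [Finset.filter_eq_empty_iff.2]
    · simp
    · intro p hp
      rw [Finset.mem_product] at hp
      exact hno _ hp.1 _ hp.2
  | succ n ih =>
    have hex : ∃ v ∈ S, (v ≠ r ∧ T.Adj l v) ∨ (v ≠ l ∧ T.Adj r v) := by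
      obtain ⟨b, hb, c, hcS, hcB, hbc⟩ := hconn {l, r} hpairsub ⟨l, by simp⟩ (by
        intro he
        rw [he] at hpaircard
        omega)
      simp only [Finset.mem_insert, Finset.mem_singleton, not_or] at hb hcB
      rcases hb with rfl | rfl
      · exact ⟨c, hcS, Or.inl ⟨hcB.2, hbc⟩⟩
      · exact ⟨c, hcS, Or.inr ⟨hcB.1, hbc⟩⟩
    obtain ⟨x, l', r', p, hx, hl'S, hr'S, hl'x, hr'x, hext, hlr2, hleaf, hpeel⟩ :=
      exists_peeling (W := W) hc hf hf' hlS hrS hl hr hlr (hconn.exists_adj (by omega)) hex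
    obtain ⟨G', hthin, hG'⟩ := hpeel G A h
    have hl'm : l' ∈ S.erase x := Finset.mem_erase.2 ⟨hl'x, hl'S⟩
    have hr'm : r' ∈ S.erase x := Finset.mem_erase.2 ⟨hr'x, hr'S⟩
    have hext' : ∀ v ∈ S.erase x, l' ≤ v ∧ v ≤ r' := fun v hv =>
      hext v (Finset.mem_erase.1 hv).2 (Finset.mem_erase.1 hv).1
    have hlt : l' < r' := lt_of_le_of_ne (hext' r' hr'm).1 hlr2.ne
    have := ih (S := S.erase x) (by rw [Finset.card_erase_of_mem hx]; omega)
      (hconn.erase_leaf hx hleaf) hl'm hr'm (fun v hv => (hext' v hv).1)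
      (fun v hv => (hext' v hv).2) hlr2 G' (by rwa [Finset.coe_erase]) hlt
      (by
        intro v hv
        rcases Finset.mem_insert.1 hv with rfl | hv
        · exact hl'm
        · rwa [Finset.mem_singleton.1 hv])
      (Finset.card_pair hlt.ne)
    have h2 := hthin.adjPairs_le
    linarith

theorem colorableOn_of_connected (hc : ¬ IsCrossing T) (hf : ¬ HasRightFork T)
    (hf' : ¬ HasLeftFork T) (S : Finset V) (hconn : ConnectedOn T S) (hS : 2 ≤ S.card)
    (G : SimpleGraph W) (A : Finset W) (h : ¬ CopyOn T ↑S G ↑A) :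
    ColorableOn G A (2 * S.card - 3) := by
  classical
  induction S using Finset.strongInduction generalizing A with
  | H S ih =>
    have hne : S.Nonempty := Finset.card_pos.1 (by omega)
    set l := S.min' hne
    have hlS : l ∈ S := S.min'_mem hne
    have hl : ∀ v ∈ S, l ≤ v := fun v hv => S.min'_le v hv
    obtain ⟨s, hs, hls⟩ := hconn.exists_adj hS l hlS
    have hN : (S.filter fun v => T.Adj l v).Nonempty := ⟨s, by simp [hs, hls]⟩
    obtain ⟨hrS, hlr⟩ := Finset.mem_filter.1 (Finset.max'_mem _ hN)
    have hmax : ∀ v ∈ S, T.Adj l v → v ≤ Finset.max' _ hN := fun v hv hlv =>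
      Finset.le_max' _ _ (Finset.mem_filter.2 ⟨hv, hlv⟩)
    set r := Finset.max' _ hN
    have hlr' : l < r := lt_of_le_of_ne (hl r hrS) hlr.ne
    by_cases hbeyond : ∃ t ∈ S, r < t
    · obtain ⟨t, ht, hrt⟩ := hbeyond
      have hcut := not_adj_across_farthest hc hl hlr hmax
      have hsub1 : S.filter (· ≤ r) ⊂ S := Finset.filter_ssubset.2 ⟨t, ht, hrt.not_ge⟩
      have hsub2 : S.filter (r ≤ ·) ⊂ S := Finset.filter_ssubset.2 ⟨l, hlS, hlr'.not_ge⟩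
      have hconn1 : ConnectedOn T (S.filter (· ≤ r)) := by
        refine hconn.of_cut (r := r) (Finset.filter_subset _ _) ?_
        intro u hu hur v hv hvL
        simp only [Finset.mem_filter, hv, true_and, not_le] at hu hvL
        exact hcut u hu.1 v hv (lt_of_le_of_ne hu.2 hur) hvL
      have hconn2 : ConnectedOn T (S.filter (r ≤ ·)) := by
        refine hconn.of_cut (r := r) (Finset.filter_subset _ _) ?_
        intro u hu hur v hv hvL huv
        simp only [Finset.mem_filter, hv, true_and, not_le] at hu hvL
        exact hcut v hv u hu.1 hvL (lt_of_le_of_ne hu.2 hur.symm) huv.symm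
      have hcard1 : 2 ≤ (S.filter (· ≤ r)).card :=
        Finset.one_lt_card.2 ⟨l, by simp [hlS, hlr'.le], r, by simp [hrS], hlr'.ne⟩
      have hcard2 : 2 ≤ (S.filter (r ≤ ·)).card :=
        Finset.one_lt_card.2 ⟨r, by simp [hrS], t, by simp [ht, hrt.le], hrt.ne⟩
      have hcard : (S.filter (· ≤ r)).card + (S.filter (r ≤ ·)).card = S.card + 1 := by
        rw [← Finset.card_union_add_card_inter, ← Finset.filter_or, ← Finset.filter_and]
        congr 1
        · rw [Finset.filter_true_of_mem fun v _ => le_total v r]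
        · rw [Finset.card_eq_one]
          refine ⟨r, ?_⟩
          ext v
          simp only [Finset.mem_filter, Finset.mem_singleton]
          exact ⟨fun hv => le_antisymm hv.2.1 hv.2.2, fun e => by simp [e, hrS]⟩
      have := colorableOn_of_split hrS hcut
        (fun B hB => ih _ hsub1 hconn1 hcard1 B (by simpa using hB))
        (fun B hB => ih _ hsub2 hconn2 hcard2 B (by simpa using hB)) h
      exact this.mono (by omega)
    · push Not at hbeyond
      have := colorableOn_of_adjPairs_le (G := G) (A := A) (d := 2 * (S.card - 2)) fun B hB => ?_
      · exact this.mono (by omega)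
      · exact adjPairs_le_of_segment hc hf hf' (by omega) hconn hlS hrS hl hbeyond hlr G B
          fun hcopy => h (hcopy.mono (by exact_mod_cast hB))

end UpperBounds

/-! ### Forks, bonnets and cycles -/

section Bonnets

variable {V W : Type*} [LinearOrder V] [LinearOrder W]

theorem ContainsCopy.hasRightFork {T : SimpleGraph V} {G : SimpleGraph W} (h : ContainsCopy T G)
    (hT : HasRightFork T) : HasRightFork G := by
  obtain ⟨φ, hφ⟩ := h
  obtain ⟨u₁, u₂, u₃, u₄, u₅, h1, h2, h3, h4, h5, h6, h7⟩ := hT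
  exact ⟨φ u₁, φ u₂, φ u₃, φ u₄, φ u₅, φ.lt_iff_lt.2 h1, φ.le_iff_le.2 h2, φ.lt_iff_lt.2 h3,
    φ.le_iff_le.2 h4, hφ _ _ h5, hφ _ _ h6, hφ _ _ h7⟩

theorem ContainsCopy.hasLeftFork {T : SimpleGraph V} {G : SimpleGraph W} (h : ContainsCopy T G)
    (hT : HasLeftFork T) : HasLeftFork G := by
  obtain ⟨φ, hφ⟩ := h
  obtain ⟨u₁, u₂, u₃, u₄, u₅, h1, h2, h3, h4, h5, h6, h7⟩ := hT
  exact ⟨φ u₁, φ u₂, φ u₃, φ u₄, φ u₅, φ.le_iff_le.2 h1, φ.lt_iff_lt.2 h2, φ.le_iff_le.2 h3,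
    φ.lt_iff_lt.2 h4, hφ _ _ h5, hφ _ _ h6, hφ _ _ h7⟩

theorem ContainsBonnet.hasFork {T : SimpleGraph V} (h : ContainsBonnet T) :
    HasRightFork T ∨ HasLeftFork T := by
  obtain ⟨n, B, ⟨-, u₁, u₂, u₃, u₄, u₅, -, h⟩, hBT⟩ := h
  rcases h with ⟨h1, h2, h3, h4, hE⟩ | ⟨h1, h2, h3, h4, hE⟩
  · refine Or.inl (hBT.hasRightFork ⟨u₁, u₂, u₃, u₄, u₅, h1, h2, h3, h4, ?_, ?_, ?_⟩) <;>
      rw [← SimpleGraph.mem_edgeSet, hE] <;> simp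
  · refine Or.inr (hBT.hasLeftFork ⟨u₁, u₂, u₃, u₄, u₅, h1, h2, h3, h4, ?_, ?_, ?_⟩) <;>
      rw [← SimpleGraph.mem_edgeSet, hE] <;> simp

theorem containsBonnet_of_card {T : SimpleGraph V} {u₁ u₂ u₃ u₄ u₅ : V}
    (hcard : ({u₁, u₂, u₃, u₄, u₅} : Finset V).card = 4 ∨
      ({u₁, u₂, u₃, u₄, u₅} : Finset V).card = 5)
    (h : (u₁ < u₂ ∧ u₂ ≤ u₃ ∧ u₃ < u₄ ∧ u₄ ≤ u₅ ∧ T.Adj u₁ u₂ ∧ T.Adj u₁ u₅ ∧ T.Adj u₃ u₄) ∨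
      (u₁ ≤ u₂ ∧ u₂ < u₃ ∧ u₃ ≤ u₄ ∧ u₄ < u₅ ∧ T.Adj u₁ u₅ ∧ T.Adj u₄ u₅ ∧ T.Adj u₂ u₃)) :
    ContainsBonnet T := by
  set S : Finset V := {u₁, u₂, u₃, u₄, u₅} with hS
  set e : Fin S.card ↪o V := S.orderEmbOfFin rfl with he
  have hrange : ∀ u ∈ S, ∃ w, e w = u := fun u hu => by
    have : u ∈ Set.range e := by
      rw [he, Finset.range_orderEmbOfFin]
      exact hu
    exact this
  obtain ⟨w₁, h₁⟩ := hrange u₁ (by simp [hS])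
  obtain ⟨w₂, h₂⟩ := hrange u₂ (by simp [hS])
  obtain ⟨w₃, h₃⟩ := hrange u₃ (by simp [hS])
  obtain ⟨w₄, h₄⟩ := hrange u₄ (by simp [hS])
  obtain ⟨w₅, h₅⟩ := hrange u₅ (by simp [hS])
  have hall : ∀ x, x = w₁ ∨ x = w₂ ∨ x = w₃ ∨ x = w₄ ∨ x = w₅ := by
    intro x
    have hx : e x ∈ S := Finset.orderEmbOfFin_mem S rfl x
    simpa only [hS, Finset.mem_insert, Finset.mem_singleton, ← h₁, ← h₂, ← h₃, ← h₄, ← h₅,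
      e.injective.eq_iff] using hx
  rw [← h₁, ← h₂, ← h₃, ← h₄, ← h₅] at h
  simp only [e.lt_iff_lt, e.le_iff_le] at h
  -- the bonnet with three given edges, each of which is an edge of `T`
  have hcopy : ∀ a b c d p q : Fin S.card, T.Adj (e a) (e b) → T.Adj (e c) (e d) →
      T.Adj (e p) (e q) → ContainsCopy (SimpleGraph.fromEdgeSet {s(a, b), s(c, d), s(p, q)}) T := by
    intro a b c d p q h1 h2 h3
    refine ⟨e, fun u v huv => ?_⟩
    obtain ⟨huv, -⟩ := (SimpleGraph.fromEdgeSet_adj _).1 huv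
    simp only [Set.mem_insert_iff, Set.mem_singleton_iff, Sym2.eq_iff] at huv
    rcases huv with (⟨rfl, rfl⟩ | ⟨rfl, rfl⟩) | (⟨rfl, rfl⟩ | ⟨rfl, rfl⟩) | ⟨rfl, rfl⟩ | ⟨rfl, rfl⟩
    exacts [h1, h1.symm, h2, h2.symm, h3, h3.symm]
  have hedge : ∀ a b c d p q : Fin S.card, a ≠ b → c ≠ d → p ≠ q →
      (SimpleGraph.fromEdgeSet {s(a, b), s(c, d), s(p, q)}).edgeSet =
        {s(a, b), s(c, d), s(p, q)} := by
    intro a b c d p q h1 h2 h3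
    rw [SimpleGraph.edgeSet_fromEdgeSet, sdiff_eq_left, Set.disjoint_left]
    rintro x (rfl | rfl | rfl) hx
    exacts [h1 (by simpa using hx), h2 (by simpa using hx), h3 (by simpa using hx)]
  rcases h with ⟨h1, h2, h3, h4, h5, h6, h7⟩ | ⟨h1, h2, h3, h4, h5, h6, h7⟩
  · refine ⟨S.card, _, ⟨by simpa using hcard, w₁, w₂, w₃, w₄, w₅, hall,
      Or.inl ⟨h1, h2, h3, h4, hedge _ _ _ _ _ _ ?_ ?_ ?_⟩⟩, hcopy _ _ _ _ _ _ h5 h6 h7⟩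
    exacts [h1.ne, (((h1.trans_le h2).trans h3).trans_le h4).ne, h3.ne]
  · refine ⟨S.card, _, ⟨by simpa using hcard, w₁, w₂, w₃, w₄, w₅, hall,
      Or.inr ⟨h1, h2, h3, h4, hedge _ _ _ _ _ _ ?_ ?_ ?_⟩⟩, hcopy _ _ _ _ _ _ h5 h6 h7⟩
    exacts [(((h1.trans_lt h2).trans_le h3).trans h4).ne, h4.ne, h2.ne]

theorem card_eq_four_or_five {V : Type*} [DecidableEq V] {u₁ u₂ u₃ u₄ u₅ : V} (h12 : u₁ ≠ u₂)
    (h13 : u₁ ≠ u₃) (h14 : u₁ ≠ u₄) (h15 : u₁ ≠ u₅) (h24 : u₂ ≠ u₄) (h25 : u₂ ≠ u₅)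
    (h34 : u₃ ≠ u₄) (h35 : u₃ ≠ u₅) (h : ¬ (u₂ = u₃ ∧ u₄ = u₅)) :
    ({u₁, u₂, u₃, u₄, u₅} : Finset V).card = 4 ∨ ({u₁, u₂, u₃, u₄, u₅} : Finset V).card = 5 := by
  by_cases h23 : u₂ = u₃ <;> by_cases h45 : u₄ = u₅
  · exact (h ⟨h23, h45⟩).elim
  · subst h23
    left
    simp [*]
  · subst h45
    left
    simp [*]
  · right
    simp [*]

/-- In a forest, a fork is not a triangle, so it is a bonnet. -/
theorem not_hasFork_of_isAcyclic {T : SimpleGraph V} (hT : T.IsAcyclic)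
    (hB : ¬ ContainsBonnet T) : ¬ HasRightFork T ∧ ¬ HasLeftFork T := by
  have htri : ∀ a b c, T.Adj a b → T.Adj a c → T.Adj b c → False := by
    intro a b c hab hac hbc
    obtain ⟨u, w, hw, -⟩ := SimpleGraph.is3Clique_iff_exists_cycle_length_three.1
      ⟨{a, b, c}, SimpleGraph.is3Clique_triple_iff.2 ⟨hab, hac, hbc⟩⟩
    exact hT w hw
  constructor
  · rintro ⟨u₁, u₂, u₃, u₄, u₅, h1, h2, h3, h4, h5, h6, h7⟩
    by_cases h : u₂ = u₃ ∧ u₄ = u₅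
    · obtain ⟨rfl, rfl⟩ := h
      exact htri _ _ _ h5 h6 h7
    · exact hB (containsBonnet_of_card (card_eq_four_or_five h1.ne (by order) (by order) (by order)
        (by order) (by order) h3.ne (by order) h) (Or.inl ⟨h1, h2, h3, h4, h5, h6, h7⟩))
  · rintro ⟨u₁, u₂, u₃, u₄, u₅, h1, h2, h3, h4, h5, h6, h7⟩
    by_cases h : u₄ = u₃ ∧ u₂ = u₁
    · obtain ⟨rfl, rfl⟩ := h
      exact htri _ _ _ h7 h5 h6
    · have hrev : ({u₁, u₂, u₃, u₄, u₅} : Finset V) = {u₅, u₄, u₃, u₂, u₁} := by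
        ext x
        simp only [Finset.mem_insert, Finset.mem_singleton]
        tauto
      have hcard := card_eq_four_or_five h4.ne' (show u₅ ≠ u₃ by order) (show u₅ ≠ u₂ by order)
        (show u₅ ≠ u₁ by order) (show u₄ ≠ u₂ by order) (show u₄ ≠ u₁ by order) h2.ne'
        (show u₃ ≠ u₁ by order) h
      rw [← hrev] at hcard
      exact hB (containsBonnet_of_card hcard (Or.inr ⟨h1, h2, h3, h4, h5, h6, h7⟩))

/-- Let `m` be the leftmost vertex of a cycle in a non-crossing ordered graph, and `a < b` its
neighbours on the cycle. The cycle has an edge from `a` to the right of `a`, and this edge stays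
below the edge `mb`. -/
theorem isAcyclic_of_not_hasRightFork {T : SimpleGraph V} (hc : ¬ IsCrossing T)
    (hf : ¬ HasRightFork T) : T.IsAcyclic := by
  classical
  intro v w hw
  obtain ⟨m, hm, hmin⟩ : ∃ m ∈ w.support, ∀ x ∈ w.support, m ≤ x := by
    have hne : w.support.toFinset.Nonempty := ⟨v, by simp⟩
    refine ⟨w.support.toFinset.min' hne, by simpa using w.support.toFinset.min'_mem hne,
      fun x hx => Finset.min'_le _ _ (by simpa using hx)⟩
  have key : ∀ a b (q : T.Walk a b), (∀ x ∈ q.support, m < x) → T.Adj m a → T.Adj m b →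
      a < b → False := by
    intro a b q hq hma hmb hab
    obtain ⟨d, hd, hd1, hd2⟩ := q.exists_boundary_dart {x | x ≤ a} le_rfl hab.not_ge
    have h1 := hq _ (q.dart_fst_mem_support_of_mem_darts hd)
    simp only [Set.mem_ofPred_eq, not_le] at hd1 hd2
    rcases hd1.eq_or_lt with he | hlt
    · rcases le_or_gt d.snd b with hle | hgt
      · exact hf ⟨m, a, a, d.snd, b, he ▸ h1, le_rfl, hd2, hle, hma, hmb, he ▸ d.adj⟩
      · exact hc ⟨m, b, a, d.snd, hmb, he ▸ d.adj, he ▸ h1, hab, hgt⟩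
    · exact hc ⟨m, a, d.fst, d.snd, hma, d.adj, h1, hlt, hd2⟩
  have hrot := hw.rotate hm
  have hsupp : ∀ x ∈ (w.rotate m hm).support, m ≤ x := fun x hx =>
    hmin x (by simpa using hx)
  generalize w.rotate m hm = c at hrot hsupp
  cases c with
  | nil => exact hrot.ne_nil rfl
  | @cons _ a _ hma p =>
    obtain ⟨hp, hedge⟩ := (SimpleGraph.Walk.cons_isCycle_iff _ _).1 hrot
    have hp' := hp.reverse
    have hedge' : s(m, a) ∉ p.reverse.edges := by simpa using hedge
    have hsupp' : ∀ x ∈ p.reverse.support, m ≤ x := fun x hx =>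
      hsupp x (by simp at hx; simp [hx])
    generalize p.reverse = r at hp' hedge' hsupp'
    cases r with
    | nil => exact T.irrefl hma
    | @cons _ b _ hmb q =>
      obtain ⟨-, hmq⟩ := (SimpleGraph.Walk.cons_isPath_iff _ _).1 hp'
      have hlt : ∀ x ∈ q.support, m < x := fun x hx =>
        lt_of_le_of_ne (hsupp' x (by simp [hx])) fun e => hmq (e ▸ hx)
      rcases lt_trichotomy a b with h | rfl | h
      · exact key a b q.reverse (by simpa using hlt) hma hmb h
      · exact hedge' (by simp)
      · exact key b a q hlt hmb hma h

end Bonnets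

/-! ### Bounds for the extremal chromatic number -/

section Chromatic

variable {V W : Type*} [LinearOrder V] [LinearOrder W] {T : SimpleGraph V}

theorem ColorableOn.colorable {n m : ℕ} {G : SimpleGraph (Fin n)}
    (h : ColorableOn G Finset.univ m) : G.Colorable m := by
  obtain ⟨c, h1, h2⟩ := h
  exact ⟨SimpleGraph.Coloring.mk (fun v => (⟨c v, h1 v (Finset.mem_univ _)⟩ : Fin m))
    fun {v w} hvw he => h2 v (Finset.mem_univ _) w (Finset.mem_univ _) hvw
      (congrArg Fin.val he)⟩

theorem fOrd_le_of_colorableOn {m : ℕ} [Fintype V]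
    (h : ∀ (n : ℕ) (G : SimpleGraph (Fin n)),
      ¬ CopyOn T ↑(Finset.univ : Finset V) G ↑(Finset.univ : Finset (Fin n)) →
        ColorableOn G Finset.univ m) : fOrd T ≤ m := by
  refine iSup₂_le fun G hG => ?_
  refine SimpleGraph.chromaticNumber_le_iff_colorable.2 (h G.1 G.2 ?_).colorable
  rw [Finset.coe_univ, Finset.coe_univ, copyOn_univ_iff]
  exact hG

theorem lt_fOrd [Fintype W] {G : SimpleGraph W} {m : ℕ} (h : ¬ ContainsCopy T G)
    (hG : ¬ G.Colorable m) : (m : ℕ∞) < fOrd T := by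
  by_contra! hle
  set e : Fin (Fintype.card W) ≃o W := Fintype.orderIsoFinOfCardEq W rfl
  have hG' : ¬ ContainsCopy T (G.comap e) := by
    rintro ⟨φ, hφ⟩
    exact h ⟨φ.trans e.toOrderEmbedding, fun u v huv => hφ u v huv⟩
  have hchrom : (G.comap e).chromaticNumber ≤ m :=
    (le_iSup₂ (f := fun (G : Σ n : ℕ, SimpleGraph (Fin n)) (_ : G ∈ Forb T) =>
      G.2.chromaticNumber) ⟨_, G.comap e⟩ hG').trans hle
  obtain ⟨c⟩ := SimpleGraph.chromaticNumber_le_iff_colorable.1 hchrom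
  exact hG ⟨SimpleGraph.Coloring.mk (fun v => c (e.symm v)) fun {v w} hvw =>
    c.valid (by simpa using hvw)⟩

theorem card_sub_one_le_fOrd [Fintype V] (hV : 2 ≤ Fintype.card V) :
    ((Fintype.card V - 1 : ℕ) : ℕ∞) ≤ fOrd T := by
  obtain ⟨k, hk⟩ : ∃ k, Fintype.card V = k + 2 := ⟨Fintype.card V - 2, by omega⟩
  have : (k : ℕ∞) < fOrd T := by
    refine lt_fOrd (G := (⊤ : SimpleGraph (Fin (k + 1)))) ?_ ?_
    · rintro ⟨φ, -⟩
      have := Fintype.card_le_of_injective φ φ.injective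
      rw [Fintype.card_fin] at this
      omega
    · rintro ⟨c⟩
      have hinj : Function.Injective c := fun v w hvw => by
        by_contra hne
        exact c.valid (show (⊤ : SimpleGraph (Fin (k + 1))).Adj v w from hne) hvw
      have := Fintype.card_le_of_injective c hinj
      simp at this
  rw [hk]
  exact_mod_cast Order.add_one_le_of_lt this

theorem fOrd_le_two_pow [Fintype V] (hc : ¬ IsCrossing T) (hf : ¬ HasRightFork T)
    (hf' : ¬ HasLeftFork T) : fOrd T ≤ ((2 ^ Fintype.card V : ℕ) : ℕ∞) :=
  fOrd_le_of_colorableOn fun _ G => colorableOn_two_pow hc hf hf' Finset.univ G _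

theorem fOrd_le_of_connected [Fintype V] (hc : ¬ IsCrossing T) (hf : ¬ HasRightFork T)
    (hf' : ¬ HasLeftFork T) (hT : T.Connected) (hV : 2 ≤ Fintype.card V) :
    fOrd T ≤ ((2 * Fintype.card V - 3 : ℕ) : ℕ∞) :=
  fOrd_le_of_colorableOn fun _ G =>
    colorableOn_of_connected hc hf hf' Finset.univ (connectedOn_univ hT) hV G _

/-! ### Shift graphs -/

/-- The shift graph: the pairs `(a, b)` with `a < b`, in lexicographic order, where `(a, b)` is
adjacent to `(b, c)`. The pairs with `b ≤ a` are kept as isolated vertices. -/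
def shiftGraph (N : ℕ) : SimpleGraph (Fin N ×ₗ Fin N) :=
  SimpleGraph.fromRel fun x y => (ofLex x).1 < (ofLex x).2 ∧ (ofLex x).2 = (ofLex y).1 ∧
    (ofLex y).1 < (ofLex y).2

theorem shiftGraph_adj_of_lt {N : ℕ} {x y : Fin N ×ₗ Fin N} (hxy : x < y)
    (h : (shiftGraph N).Adj x y) : (ofLex x).1 < (ofLex x).2 ∧ (ofLex x).2 = (ofLex y).1 ∧
      (ofLex y).1 < (ofLex y).2 := by
  obtain ⟨-, h | ⟨h1, h2, h3⟩⟩ := h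
  · exact h
  · have := (Prod.Lex.le_iff.1 hxy.le).elim le_of_lt fun h => h.1.le
    exact absurd (this.trans_lt h1) (h2 ▸ lt_irrefl _)

/-- The right neighbours of `(a, b)` start with `b`, hence so do all pairs between two of them, and
these pairs are pairwise nonadjacent. -/
theorem not_hasRightFork_shiftGraph (N : ℕ) : ¬ HasRightFork (shiftGraph N) := by
  rintro ⟨u₁, u₂, u₃, u₄, u₅, h1, h2, h3, h4, h5, h6, h7⟩
  have hfst : ∀ x y : Fin N ×ₗ Fin N, x ≤ y → (ofLex x).1 ≤ (ofLex y).1 := fun x y hxy =>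
    (Prod.Lex.le_iff.1 hxy).elim le_of_lt fun h => h.1.le
  obtain ⟨-, e1, -⟩ := shiftGraph_adj_of_lt h1 h5
  obtain ⟨-, e2, -⟩ := shiftGraph_adj_of_lt (((h1.trans_le h2).trans h3).trans_le h4) h6
  obtain ⟨e3, e4, -⟩ := shiftGraph_adj_of_lt h3 h7
  have i1 := hfst _ _ h2
  have i2 := hfst _ _ h4
  rw [← e1] at i1
  rw [← e2, ← e4] at i2
  exact absurd (e3.trans_le (i2.trans i1)) (lt_irrefl _)

theorem not_colorable_shiftGraph (n : ℕ) : ¬ (shiftGraph (2 ^ n + 1)).Colorable n := by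
  classical
  rintro ⟨c⟩
  -- the colours on the pairs starting with `a` determine `a`
  set C : Fin (2 ^ n + 1) → Finset (Fin n) := fun a =>
    Finset.univ.filter fun i => ∃ b, a < b ∧ c (toLex (a, b)) = i with hC
  have hlt : ∀ a b, a < b → C a ≠ C b := by
    intro a b hab he
    have h1 : c (toLex (a, b)) ∈ C a := by
      simp only [hC, Finset.mem_filter, Finset.mem_univ, true_and]
      exact ⟨b, hab, rfl⟩
    rw [he] at h1
    simp only [hC, Finset.mem_filter, Finset.mem_univ, true_and] at h1
    obtain ⟨d, hbd, hd⟩ := h1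
    refine c.valid (v := toLex (a, b)) (w := toLex (b, d)) ⟨?_, Or.inl ⟨hab, rfl, hbd⟩⟩ hd.symm
    intro h
    exact hab.ne (congrArg (fun x => (ofLex x).1) h)
  have hinj : Function.Injective C := by
    intro a b he
    by_contra hne
    rcases lt_or_gt_of_ne hne with h | h
    · exact hlt a b h he
    · exact hlt b a h he.symm
  have := Fintype.card_le_of_injective C hinj
  simp at this

theorem fOrd_eq_top_of_hasRightFork (h : HasRightFork T) : fOrd T = ⊤ :=
  ENat.eq_top_iff_forall_gt.2 fun m => lt_fOrd
    (fun hcopy => not_hasRightFork_shiftGraph _ (hcopy.hasRightFork h)) (not_colorable_shiftGraph m)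

theorem fOrd_eq_top_of_hasLeftFork (h : HasLeftFork T) : fOrd T = ⊤ := by
  refine ENat.eq_top_iff_forall_gt.2 fun m => ?_
  -- the shift graph with the reverse ordering
  refine lt_fOrd (W := (Fin (2 ^ m + 1) ×ₗ Fin (2 ^ m + 1))ᵒᵈ) (G := shiftGraph (2 ^ m + 1))
    (fun hcopy => ?_) (not_colorable_shiftGraph m)
  obtain ⟨u₁, u₂, u₃, u₄, u₅, h1, h2, h3, h4, h5, h6, h7⟩ := hcopy.hasLeftFork h
  exact not_hasRightFork_shiftGraph _
    ⟨u₅, u₄, u₃, u₂, u₁, h4, h3, h2, h1, h6.symm, h5.symm, h7.symm⟩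

theorem fOrd_ne_top_iff [Fintype V] (hc : ¬ IsCrossing T) :
    fOrd T ≠ ⊤ ↔ ¬ HasRightFork T ∧ ¬ HasLeftFork T := by
  constructor
  · exact fun h => ⟨fun hf => h (fOrd_eq_top_of_hasRightFork hf),
      fun hf => h (fOrd_eq_top_of_hasLeftFork hf)⟩
  · exact fun h => ne_top_of_le_ne_top (ENat.natCast_ne_top _) (fOrd_le_two_pow hc h.1 h.2)

theorem hasNoFork_iff (hc : ¬ IsCrossing T) :
    ¬ HasRightFork T ∧ ¬ HasLeftFork T ↔ T.IsAcyclic ∧ ¬ ContainsBonnet T :=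
  ⟨fun h => ⟨isAcyclic_of_not_hasRightFork hc h.1, fun hB => hB.hasFork.elim h.1 h.2⟩,
    fun h => not_hasFork_of_isAcyclic h.1 h.2⟩

/-! ### Forests on two or three vertices -/

theorem fOrd_le_one_of_card_eq_two [Fintype V] (hV : Fintype.card V = 2) :
    fOrd T ≤ ((1 : ℕ) : ℕ∞) := by
  set e : Fin 2 ≃o V := Fintype.orderIsoFinOfCardEq V hV
  refine fOrd_le_of_colorableOn fun n G h => colorableOn_of_edgeless
    (edgeless_of_not_copyOn_pair (l := e 0) (r := e 1) (e.lt_iff_lt.2 (by decide)) ?_ h)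
  intro v _
  obtain ⟨i, rfl⟩ := e.surjective v
  fin_cases i <;> simp

theorem fOrd_le_two_of_card_eq_three [Fintype V] (hV : Fintype.card V = 3) (hT : T.IsAcyclic) :
    fOrd T ≤ ((2 : ℕ) : ℕ∞) := by
  classical
  set e : Fin 3 ≃o V := Fintype.orderIsoFinOfCardEq V hV
  obtain ⟨a, b, c, hab, hbc, hall⟩ : ∃ a b c : V, a < b ∧ b < c ∧ ∀ v, v = a ∨ v = b ∨ v = c := by
    refine ⟨e 0, e 1, e 2, e.lt_iff_lt.2 (by decide), e.lt_iff_lt.2 (by decide), fun v => ?_⟩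
    obtain ⟨i, rfl⟩ := e.surjective v
    fin_cases i <;> simp
  refine fOrd_le_of_colorableOn fun n G h => ?_
  have hcopy : ∀ x y z, x < y → y < z → (T.Adj a b → G.Adj x y) → (T.Adj a c → G.Adj x z) →
      (T.Adj b c → G.Adj y z) → False := by
    intro x y z hxy hyz h1 h2 h3
    have hba := hab.ne'
    have hcb := hbc.ne'
    have hca := (hab.trans hbc).ne'
    refine h ⟨fun v => if v = a then x else if v = b then y else z, by simp, ?_, ?_⟩
    · intro u _ v _ huv
      have hxz := hxy.trans hyz
      rcases hall u with rfl | rfl | rfl <;> rcases hall v with rfl | rfl | rfl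
      · exact huv.false.elim
      · simpa [hba] using hxy
      · simpa [hca, hcb] using hxz
      · exact (huv.asymm hab).elim
      · exact huv.false.elim
      · simpa [hba, hca, hcb] using hyz
      · exact (huv.asymm (hab.trans hbc)).elim
      · exact (huv.asymm hbc).elim
      · exact huv.false.elim
    · intro u _ v _ huv
      rcases hall u with rfl | rfl | rfl <;> rcases hall v with rfl | rfl | rfl
      · exact (T.irrefl huv).elim
      · simpa [hba] using h1 huv
      · simpa [hca, hcb] using h2 huv
      · simpa [hba] using (h1 huv.symm).symm
      · exact (T.irrefl huv).elim
      · simpa [hba, hca, hcb] using h3 huv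
      · simpa [hca, hcb] using (h2 huv.symm).symm
      · simpa [hba, hca, hcb] using (h3 huv.symm).symm
      · exact (T.irrefl huv).elim
  by_cases hTab : T.Adj a b
  · by_cases hTbc : T.Adj b c
    · -- `T` is contained in a monotone path: colour by the existence of a left neighbour
      have hTac : ¬ T.Adj a c := fun hTac => by
        obtain ⟨u, w, hw, -⟩ := SimpleGraph.is3Clique_iff_exists_cycle_length_three.1
          ⟨{a, b, c}, SimpleGraph.is3Clique_triple_iff.2 ⟨hTab, hTac, hTbc⟩⟩
        exact hT w hw
      have key : ∀ x y, x < y → G.Adj x y →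
          (if ∃ w, w < x ∧ G.Adj w x then 1 else 0) ≠ if ∃ w, w < y ∧ G.Adj w y then 1 else 0 := by
        intro x y hxy hadj
        rw [if_neg, if_pos ⟨x, hxy, hadj⟩]
        · exact Nat.zero_ne_one
        · rintro ⟨w, hwx, hw⟩
          exact hcopy w x y hwx hxy (fun _ => hw) (fun h => (hTac h).elim) fun _ => hadj
      refine ⟨fun x => if ∃ w, w < x ∧ G.Adj w x then 1 else 0, ?_, ?_⟩
      · intro x _
        simp only
        split_ifs <;> omega
      · intro x _ y _ hxy
        rcases lt_or_gt_of_ne hxy.ne with hlt | hlt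
        · exact key x y hlt hxy
        · exact (key y x hlt hxy.symm).symm
    · -- no vertex has two right neighbours
      refine colorableOn_of_degenerate (d := 1) fun B _ hB => ⟨B.min' hB, B.min'_mem hB, ?_⟩
      have key : ∀ y ∈ B, ∀ z ∈ B, G.Adj (B.min' hB) y → G.Adj (B.min' hB) z → ¬ y < z := by
        intro y hy z hz hxy hxz hyz
        exact hcopy (B.min' hB) y z (lt_of_le_of_ne (B.min'_le y hy) hxy.ne) hyz (fun _ => hxy)
          (fun _ => hxz) fun h => (hTbc h).elim
      refine Finset.card_le_one.2 fun y hy z hz => ?_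
      rw [Finset.mem_filter] at hy hz
      exact le_antisymm (not_lt.1 (key z hz.1 y hy.1 hz.2 hy.2))
        (not_lt.1 (key y hy.1 z hz.1 hy.2 hz.2))
  · -- no vertex has two left neighbours
    refine colorableOn_of_degenerate (d := 1) fun B _ hB => ⟨B.max' hB, B.max'_mem hB, ?_⟩
    have key : ∀ y ∈ B, ∀ z ∈ B, G.Adj (B.max' hB) y → G.Adj (B.max' hB) z → ¬ y < z := by
      intro y hy z hz hxy hxz hyz
      exact hcopy y z (B.max' hB) hyz (lt_of_le_of_ne (B.le_max' z hz) hxz.ne')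
        (fun h => (hTab h).elim) (fun _ => hxy.symm) fun _ => hxz.symm
    refine Finset.card_le_one.2 fun y hy z hz => ?_
    rw [Finset.mem_filter] at hy hz
    exact le_antisymm (not_lt.1 (key z hz.1 y hy.1 hz.2 hy.2))
      (not_lt.1 (key y hy.1 z hz.1 hy.2 hz.2))

end Chromatic

/-! ### A tree that some graph of chromatic number `k` avoids -/

section Broom

/-- The broom on `m + 4` vertices: all vertices but `m + 2` are adjacent to the last vertex `m + 3`,
and `m + 2` is adjacent to `m + 1`. -/
def broom (m : ℕ) : SimpleGraph (Fin (m + 4)) :=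
  SimpleGraph.fromRel fun i j => i < j ∧
    ((j.val = m + 3 ∧ i.val ≠ m + 2) ∨ (j.val = m + 2 ∧ i.val = m + 1))

theorem broom_adj_iff_of_lt {m : ℕ} {i j : Fin (m + 4)} (hij : i < j) :
    (broom m).Adj i j ↔ (j.val = m + 3 ∧ i.val ≠ m + 2) ∨ (j.val = m + 2 ∧ i.val = m + 1) := by
  constructor
  · rintro ⟨-, h | h⟩
    · exact h.2
    · exact absurd h.1 hij.asymm
  · exact fun h => ⟨hij.ne, Or.inl ⟨hij, h⟩⟩

theorem not_isCrossing_broom (m : ℕ) : ¬ IsCrossing (broom m) := by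
  rintro ⟨u, v, u', v', h1, h2, h3, h4, h5⟩
  rw [broom_adj_iff_of_lt (h3.trans h4)] at h1
  rw [broom_adj_iff_of_lt (h4.trans h5)] at h2
  simp only [Fin.lt_def] at h3 h4 h5
  omega

theorem not_hasRightFork_broom (m : ℕ) : ¬ HasRightFork (broom m) := by
  rintro ⟨u₁, u₂, u₃, u₄, u₅, h1, h2, h3, h4, h5, h6, h7⟩
  rw [broom_adj_iff_of_lt h1] at h5
  rw [broom_adj_iff_of_lt (((h1.trans_le h2).trans h3).trans_le h4)] at h6
  rw [broom_adj_iff_of_lt h3] at h7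
  simp only [Fin.lt_def, Fin.le_def] at h1 h2 h3 h4
  omega

theorem not_hasLeftFork_broom (m : ℕ) : ¬ HasLeftFork (broom m) := by
  rintro ⟨u₁, u₂, u₃, u₄, u₅, h1, h2, h3, h4, h5, h6, h7⟩
  rw [broom_adj_iff_of_lt (((h1.trans_lt h2).trans_le h3).trans h4)] at h5
  rw [broom_adj_iff_of_lt h4] at h6
  rw [broom_adj_iff_of_lt h2] at h7
  simp only [Fin.lt_def, Fin.le_def] at h1 h2 h3 h4
  omega

theorem isTree_broom (m : ℕ) : (broom m).IsTree := by
  refine ⟨(SimpleGraph.connected_iff_exists_forall_reachable _).2 ⟨Fin.last (m + 3), fun i => ?_⟩,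
    isAcyclic_of_not_hasRightFork (not_isCrossing_broom m) (not_hasRightFork_broom m)⟩
  have hlast : ∀ j : Fin (m + 4), j.val < m + 2 → (broom m).Reachable (Fin.last (m + 3)) j := by
    intro j hj
    have hlt : j < Fin.last (m + 3) := Fin.lt_def.2 (by simp only [Fin.val_last]; omega)
    exact ((broom_adj_iff_of_lt hlt).2 (Or.inl ⟨rfl, by omega⟩)).symm.reachable
  rcases lt_trichotomy i.val (m + 2) with h | h | h
  · exact hlast i h
  · have hlt : (⟨m + 1, by omega⟩ : Fin (m + 4)) < i := Fin.lt_def.2 (by simp only; omega)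
    exact (hlast ⟨m + 1, by omega⟩ (by simp)).trans
      ((broom_adj_iff_of_lt hlt).2 (Or.inr ⟨h, rfl⟩)).reachable
  · rw [show i = Fin.last (m + 3) from Fin.ext (by simp only [Fin.val_last]; omega)]

/-- The eleven edges of the Moser spindle. The order of its vertices is such that every edge `uv`
with `u < v` is the shortest right edge at `u` or the longest left edge at `v`. -/
def spindleEdges : List (ℕ × ℕ) :=
  [(0, 1), (0, 2), (0, 4), (1, 2), (1, 3), (1, 5), (2, 4), (3, 5), (3, 6), (4, 6), (5, 6)]

theorem spindleEdges_avoids : ∀ p ∈ spindleEdges, ∀ q ∈ spindleEdges, ∀ s ∈ spindleEdges,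
    q.2 = p.2 → s.1 = q.1 → p.1 < q.1 → s.2 < q.2 → False := by
  decide

/-- The Moser spindle preceded by `m` vertices that are adjacent to all other vertices. -/
def extendedSpindle (m : ℕ) : SimpleGraph (Fin (m + 7)) :=
  SimpleGraph.fromRel fun i j => i < j ∧
    (i.val < m ∨ (m ≤ i.val ∧ (i.val - m, j.val - m) ∈ spindleEdges))

theorem extendedSpindle_adj_iff_of_lt {m : ℕ} {i j : Fin (m + 7)} (hij : i < j) :
    (extendedSpindle m).Adj i j ↔
      (i.val < m ∨ (m ≤ i.val ∧ (i.val - m, j.val - m) ∈ spindleEdges)) := by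
  constructor
  · rintro ⟨-, h | h⟩
    · exact h.2
    · exact absurd h.1 hij.asymm
  · exact fun h => ⟨hij.ne, Or.inl ⟨hij, h⟩⟩

/-- In a copy of the broom, the last four vertices would lie in the Moser spindle and contain an
edge that is neither shortest to the right nor longest to the left. -/
theorem not_containsCopy_broom (m : ℕ) : ¬ ContainsCopy (broom m) (extendedSpindle m) := by
  rintro ⟨φ, hφ⟩
  have hle : ∀ (i : ℕ) (hi : i < m + 4), i ≤ (φ ⟨i, hi⟩).val := by
    intro i
    induction i with
    | zero => exact fun _ => Nat.zero_le _
    | succ i ih =>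
      intro hi
      have h1 := ih (by omega)
      have h2 : φ ⟨i, by omega⟩ < φ ⟨i + 1, hi⟩ := φ.lt_iff_lt.2 (Fin.lt_def.2 (by simp))
      rw [Fin.lt_def] at h2
      omega
  have hedge : ∀ (i j : ℕ) (hi : i < m + 4) (hj : j < m + 4), m ≤ i → i < j →
      (j = m + 3 ∧ i ≠ m + 2 ∨ j = m + 2 ∧ i = m + 1) →
      ((φ ⟨i, hi⟩).val - m, (φ ⟨j, hj⟩).val - m) ∈ spindleEdges := by
    intro i j hi hj hmi hij h
    have hlt : (⟨i, hi⟩ : Fin (m + 4)) < ⟨j, hj⟩ := Fin.lt_def.2 hij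
    have h1 := (extendedSpindle_adj_iff_of_lt (φ.lt_iff_lt.2 hlt)).1
      (hφ _ _ ((broom_adj_iff_of_lt hlt).2 h))
    have h2 := hle i hi
    exact (h1.resolve_left (by omega)).2
  have hlt : ∀ (i j : ℕ) (hi : i < m + 4) (hj : j < m + 4), m ≤ i → i < j →
      (φ ⟨i, hi⟩).val - m < (φ ⟨j, hj⟩).val - m := by
    intro i j hi hj hmi hij
    have h1 : φ ⟨i, hi⟩ < φ ⟨j, hj⟩ := φ.lt_iff_lt.2 (Fin.lt_def.2 hij)
    rw [Fin.lt_def] at h1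
    have h2 := hle i hi
    omega
  exact spindleEdges_avoids
    _ (hedge m (m + 3) (by omega) (by omega) (by omega) (by omega) (by omega))
    _ (hedge (m + 1) (m + 3) (by omega) (by omega) (by omega) (by omega) (by omega))
    _ (hedge (m + 1) (m + 2) (by omega) (by omega) (by omega) (by omega) (by omega)) rfl rfl
    (hlt m (m + 1) (by omega) (by omega) (by omega) (by omega))
    (hlt (m + 2) (m + 3) (by omega) (by omega) (by omega) (by omega))

/-- In a proper colouring of the extended spindle with `m + 3` colours, the Moser spindle is left
with three colours, so the two ends of a diamond get the same colour. -/
theorem color_eq_of_diamond {m : ℕ} (c : (extendedSpindle m).Coloring (Fin (m + 3)))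
    {a b p q : Fin (m + 7)} (ha : m ≤ a.val) (hb : m ≤ b.val) (hp : m ≤ p.val) (hq : m ≤ q.val)
    (hab : c a ≠ c b) (hap : c a ≠ c p) (haq : c a ≠ c q) (hbp : c b ≠ c p) (hbq : c b ≠ c q) :
    c p = c q := by
  by_contra hpq
  have huniv : ∀ i j : Fin (m + 7), i.val < m → i < j → c i ≠ c j := fun i j hi hij =>
    c.valid ((extendedSpindle_adj_iff_of_lt hij).2 (Or.inl hi))
  set D : Finset (Fin (m + 3)) :=
    Finset.univ.image fun t : Fin m => c (⟨t.val, by omega⟩ : Fin (m + 7)) with hD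
  have hDcard : D.card = m := by
    rw [hD, Finset.card_image_of_injective, Finset.card_univ, Fintype.card_fin]
    intro s t hst
    by_contra hne
    rcases lt_or_gt_of_ne hne with h | h
    · exact huniv ⟨s.val, by omega⟩ ⟨t.val, by omega⟩ s.isLt (Fin.lt_def.2 h) hst
    · exact huniv ⟨t.val, by omega⟩ ⟨s.val, by omega⟩ t.isLt (Fin.lt_def.2 h) hst.symm
  have hnot : ∀ x : Fin (m + 7), m ≤ x.val → c x ∉ D := by
    intro x hx hmem
    obtain ⟨t, -, ht⟩ := Finset.mem_image.1 hmem
    exact huniv ⟨t.val, by omega⟩ x t.isLt (Fin.lt_def.2 (t.isLt.trans_le hx)) ht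
  have hcard : (insert (c a) (insert (c b) (insert (c p) (insert (c q) D)))).card = m + 4 := by
    rw [Finset.card_insert_of_notMem, Finset.card_insert_of_notMem, Finset.card_insert_of_notMem,
      Finset.card_insert_of_notMem, hDcard]
    · exact hnot q hq
    · simp [hpq, hnot p hp]
    · simp [hbp, hbq, hnot b hb]
    · simp [hab, hap, haq, hnot a ha]
  have := Finset.card_le_univ (insert (c a) (insert (c b) (insert (c p) (insert (c q) D))))
  rw [hcard, Fintype.card_fin] at this
  omega

theorem not_colorable_extendedSpindle (m : ℕ) : ¬ (extendedSpindle m).Colorable (m + 3) := by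
  rintro ⟨c⟩
  have hedge : ∀ (i j : ℕ) (hi : i < 7) (hj : j < 7), i < j → (i, j) ∈ spindleEdges →
      c ⟨m + i, by omega⟩ ≠ c ⟨m + j, by omega⟩ := by
    intro i j hi hj hij h
    refine c.valid ((extendedSpindle_adj_iff_of_lt (Fin.lt_def.2 (by simpa using hij))).2
      (Or.inr ⟨by simp, ?_⟩))
    simpa using h
  -- the diamonds `0, 2; 1, 4` and `3, 5; 1, 6`
  have e1 : c ⟨m + 1, by omega⟩ = c ⟨m + 4, by omega⟩ :=
    color_eq_of_diamond c (a := ⟨m + 0, by omega⟩) (b := ⟨m + 2, by omega⟩) (by simp) (by simp)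
      (by simp) (by simp) (hedge 0 2 (by omega) (by omega) (by omega) (by decide))
      (hedge 0 1 (by omega) (by omega) (by omega) (by decide))
      (hedge 0 4 (by omega) (by omega) (by omega) (by decide))
      (hedge 1 2 (by omega) (by omega) (by omega) (by decide)).symm
      (hedge 2 4 (by omega) (by omega) (by omega) (by decide))
  have e2 : c ⟨m + 1, by omega⟩ = c ⟨m + 6, by omega⟩ :=
    color_eq_of_diamond c (a := ⟨m + 3, by omega⟩) (b := ⟨m + 5, by omega⟩) (by simp) (by simp)
      (by simp) (by simp) (hedge 3 5 (by omega) (by omega) (by omega) (by decide))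
      (hedge 1 3 (by omega) (by omega) (by omega) (by decide)).symm
      (hedge 3 6 (by omega) (by omega) (by omega) (by decide))
      (hedge 1 5 (by omega) (by omega) (by omega) (by decide)).symm
      (hedge 5 6 (by omega) (by omega) (by omega) (by decide))
  exact hedge 4 6 (by omega) (by omega) (by omega) (by decide) (e1.symm.trans e2)

end Broom

end OrderedGraph

open OrderedGraph

theorem theorem3 :
    (∀ (V : Type*) [Fintype V] [LinearOrder V] (T : SimpleGraph V) (k : ℕ),
      Fintype.card V = k → 2 ≤ k → ¬ OrderedGraph.IsCrossing T →
        (OrderedGraph.fOrd T ≠ ⊤ ↔ T.IsAcyclic ∧ ¬ OrderedGraph.ContainsBonnet T) ∧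
        (OrderedGraph.fOrd T ≠ ⊤ →
          ((k - 1 : ℕ) : ℕ∞) ≤ OrderedGraph.fOrd T ∧
          OrderedGraph.fOrd T ≤ ((2 ^ k : ℕ) : ℕ∞) ∧
          (T.Connected → OrderedGraph.fOrd T ≤ ((2 * k - 3 : ℕ) : ℕ∞))) ∧
        ((k = 2 ∨ k = 3) → T.IsAcyclic →
          OrderedGraph.fOrd T = ((k - 1 : ℕ) : ℕ∞))) ∧
    (∀ k : ℕ, 4 ≤ k → ∃ T : SimpleGraph (Fin k),
      T.IsTree ∧ ¬ OrderedGraph.IsCrossing T ∧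
        (k : ℕ∞) ≤ OrderedGraph.fOrd T ∧ OrderedGraph.fOrd T ≠ ⊤) := by
  refine ⟨?_, fun k hk => ?_⟩
  · rintro V _ _ T k rfl hk hc
    refine ⟨(fOrd_ne_top_iff hc).trans (hasNoFork_iff hc), fun h => ?_, ?_⟩
    · obtain ⟨hf, hf'⟩ := (fOrd_ne_top_iff hc).1 h
      exact ⟨card_sub_one_le_fOrd hk, fOrd_le_two_pow hc hf hf',
        fun hT => fOrd_le_of_connected hc hf hf' hT hk⟩
    · rintro (hV | hV) hT
      · refine le_antisymm ?_ (card_sub_one_le_fOrd hk)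
        rw [hV]
        exact fOrd_le_one_of_card_eq_two hV
      · refine le_antisymm ?_ (card_sub_one_le_fOrd hk)
        rw [hV]
        exact fOrd_le_two_of_card_eq_three hV hT
  · obtain ⟨m, rfl⟩ : ∃ m, k = m + 4 := ⟨k - 4, by omega⟩
    refine ⟨broom m, isTree_broom m, not_isCrossing_broom m, ?_,
      (fOrd_ne_top_iff (not_isCrossing_broom m)).2
        ⟨not_hasRightFork_broom m, not_hasLeftFork_broom m⟩⟩
    exact_mod_cast Order.add_one_le_of_lt
      (lt_fOrd (not_containsCopy_broom m) (not_colorable_extendedSpindle m))
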